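/- Let $q\ge 2$, let $\pi=(\pi_k)_{k\in[q]}$ have positive entries summing to $1$, and let $Q\in\mathbb R_{>0}^{q\times q}$ be a symmetric matrix with positive entries. Put $d:=\sum_{k,\ell}\pi_k\pi_\ell Q_{k,\ell}$ and assume the equal-average-degree condition $$\sum_{\ell=1}^q Q_{k,\ell}\,\pi_\ell=d\qquad\text{for all }k\in[q].$$ Let $\lambda:=|\lambda_2(T)|$, where $T:=\frac1d\operatorname{diag}(\pi)\,Q$ and $\lambda_1(T),\dots,\lambda_q(T)$ are the eigenvalues of $T$ (with multiplicity) in decreasing order of magnitude. For an integer $n\ge2$ with $n\ge\max_{k,\ell}Q_{k,\ell}$, let $(\sigma^\star,Y)$ be drawn from the stochastic block model on $n$ vertices: the labels $\sigma^\star_1,\dots,\sigma^\star_n\in[q]$ are i.i.d. with law $\pi$ and, conditionally on $\sigma^\star$, the entries $Y_{ij}\in\{0,1\}$, $1\le i<j\le n$, are independent with $Y_{ij}\sim\mathrm{Ber}(Q_{\sigma^\star_i,\sigma^\star_j}/n)$. For $k_0,\ell_0\in[q]$ let $x_{k_0,\ell_0}:=(\mathbf 1\{\sigma^\star_1=k_0\}-\pi_{k_0})(\mathbf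 1\{\sigma^\star_2=\ell_0\}-\pi_{\ell_0})$ and, for an integer $D\ge 0$, let $$\mathrm{Corr}_{\le D}(k_0,\ell_0):=\sup_{f}\frac{\mathbb E[f(Y)\,x_{k_0,\ell_0}]}{\sqrt{\mathbb E[f(Y)^2]}},$$ the supremum being over all real polynomials $f$ of degree at most $D$ in the variables $(Y_{ij})_{i<j}$ with $\mathbb E[f(Y)^2]\neq 0$. **Theorem.** There exist constants $\delta,C>0$, depending only on $q,\pi,Q$, such that for every integer $n\ge 2$ with $n\ge\max_{k,\ell}Q_{k,\ell}$, every integer $0\le D\le n^\delta$ and all $k_0,\ell_0\in[q]$, $$\mathrm{Corr}_{\le D}(k_0,\ell_0)\le\sqrt{\frac Cn\sum_{t=1}^{D}(d\lambda^2)^t}.$$ -/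

import Mathlib

namespace SBM

/-- The pairs `i < j` of vertices: the index set of the adjacency variables `Y i j`. -/
abbrev Edge (n : ℕ) : Type := {e : Fin n × Fin n // e.1 < e.2}

/-- The joint probability of the labels `σ` and the graph `Y` in the stochastic block model on `n`
vertices: the labels are i.i.d. with law `π` and, given the labels, the edges are independent,
the pair `i < j` being an edge with probability `Q (σ i) (σ j) / n`. -/
noncomputable def prob {q : ℕ} (π : Fin q → ℝ) (Q : Matrix (Fin q) (Fin q) ℝ) (n : ℕ)
    (σ : Fin n → Fin q) (Y : Edge n → Bool) : ℝ :=
  (∏ i : Fin n, π (σ i)) *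
    ∏ e : Edge n, (if Y e = true then Q (σ e.1.1) (σ e.1.2) / n
      else 1 - Q (σ e.1.1) (σ e.1.2) / n)

/-- Expectation of a function of the labels and the graph under the stochastic block model. -/
noncomputable def expect {q : ℕ} (π : Fin q → ℝ) (Q : Matrix (Fin q) (Fin q) ℝ) (n : ℕ)
    (F : (Fin n → Fin q) → (Edge n → Bool) → ℝ) : ℝ :=
  ∑ σ : Fin n → Fin q, ∑ Y : Edge n → Bool, prob π Q n σ Y * F σ Y

/-- The average degree parameter: the expectation of `Q k l` for independent `k`, `l` of law `π`. -/
noncomputable def avgDegree {q : ℕ} (π : Fin q → ℝ) (Q : Matrix (Fin q) (Fin q) ℝ) : ℝ :=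
  ∑ k : Fin q, ∑ l : Fin q, π k * π l * Q k l

/-- The stochastic matrix `T = (1 / d) diag(π) Q`. -/
noncomputable def transition {q : ℕ} (π : Fin q → ℝ) (Q : Matrix (Fin q) (Fin q) ℝ) :
    Matrix (Fin q) (Fin q) ℝ :=
  (1 / avgDegree π Q) • (Matrix.diagonal π * Q)

/-- The modulus of the second largest eigenvalue in modulus of a real square matrix: the moduli of
its complex eigenvalues, with algebraic multiplicity, are listed in decreasing order and the entry
at position 1 (counted from 0) is read off. The default value `0` is used only for
matrices of size less than two. -/
noncomputable def secondEigenvalueAbs {q : ℕ} (T : Matrix (Fin q) (Fin q) ℝ) : ℝ :=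
  ((((T.map (algebraMap ℝ ℂ)).charpoly.roots.map (fun z : ℂ => ‖z‖)).sort
    (fun a b : ℝ => a ≥ b))).getD 1 0

/-- The value `f(Y)` of a polynomial in the entries of the adjacency matrix, with `Y e ∈ {0, 1}`. -/
noncomputable def evalGraph {n : ℕ} (f : MvPolynomial (Edge n) ℝ) (Y : Edge n → Bool) : ℝ :=
  MvPolynomial.eval (fun e => if Y e = true then (1 : ℝ) else 0) f

/-- The estimand `(1{σ u = k} - π k) (1{σ v = l} - π l)`. -/
noncomputable def estimand {q n : ℕ} (π : Fin q → ℝ) (u v : Fin n) (k l : Fin q)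
    (σ : Fin n → Fin q) : ℝ :=
  ((if σ u = k then (1 : ℝ) else 0) - π k) * ((if σ v = l then (1 : ℝ) else 0) - π l)

/-- The degree-`D` correlation with the estimand at the vertices `u`, `v`: the supremum of
`E[f(Y) x] / sqrt (E[f(Y)^2])` over the real polynomials `f` of degree at most `D` in the entries
of `Y` for which the denominator does not vanish. The supremum is taken in the extended reals, so
that it is the true supremum whether or not the ratios are bounded. -/
noncomputable def corr {q n : ℕ} (π : Fin q → ℝ) (Q : Matrix (Fin q) (Fin q) ℝ)
    (u v : Fin n) (k l : Fin q) (D : ℕ) : EReal :=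
  ⨆ f : {f : MvPolynomial (Edge n) ℝ //
      f.totalDegree ≤ D ∧ 0 < expect π Q n (fun _ Y => evalGraph f Y ^ 2)},
    ((expect π Q n (fun σ Y => evalGraph f.1 Y * estimand π u v k l σ) /
      Real.sqrt (expect π Q n (fun _ Y => evalGraph f.1 Y ^ 2)) : ℝ) : EReal)

end SBM

/-! The bound is proved by duality. If `G(σ, Y)` satisfies `E[f G] = E[f x]` for every polynomial
`f` of degree at most `D`, then Cauchy–Schwarz bounds the correlation by the norm of `G`
(`corr_le_sqrt`). Since `G` may depend on the hidden labels, it can be expanded in the products of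
`Y e - P e(σ)`, `P = Q / n`, over edge sets `β`. These are orthogonal given `σ`, with squared norms
`N β`, the means of the products of `P (1 - P)`. Against the products of `Y e - d / n` over `α`,
which span the polynomials, only `β ⊆ α` contribute. The coefficients thus solve a triangular
system, and the squared norm of `G` is the sum of `coef β ^ 2 / N β` (`corr_le_sqrt_sum_coef`).

By the equal-degree condition the kernel `Q / n - d / n` averages to zero in each variable. Hence
leaves kill moments, parts away from the roots factor out, and the solution can be supported on
admissible graphs (`sum_coef_mul_mixedMoment`). Each of these has excess `k ≥ 1`, where `k` is the
number of edges minus the number of non-root vertices; this is the source of the factor `1 / n`.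

Upper bound on coefficients: in `L²(π)` the kernel has eigenvalues of modulus at most `d λ / n`.
When every edge is expanded in eigenfunctions, orthogonality at a vertex of degree two forces its
two edges to carry the same index. So each edge costs `d λ / n`, and constants are paid only at the
half-edges at roots and branch vertices, at most `6 k` of them (`abs_mean_mul_prod_kernel_le`). The
recursion over subgraphs preserves this: a proper admissible subgraph has smaller excess and is
determined by its branch half-edges, so only a power of `D` proportional to `k - 1` is lost
(`abs_coef_le`).

Counting and lower bound on `N`: an admissible graph is explored edge by edge from `u`. A step to a
new vertex has at most `n` choices and costs nothing in `N`; each of the `k` closing steps has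
polynomially many choices in `D` and costs a constant (`card_admissibleSet_le`,
`Grown.pow_le_mean_prod`).

Altogether the graphs with `t` edges and excess `k` contribute `(d λ²) ^ t` times the `k`-th power
of a constant times `D ^ 15 / n`. For `k = 1` no power of `D` is affordable, and none occurs
(`card_admissibleSet_one_le`); for `k ≥ 2` the condition `D ^ 30 ≤ n` yields a geometric series of
order `1 / n`. Small `n` is absorbed into the constant, because the correlation never exceeds one.
-/

namespace SBM

/-! ### Independent labels: locality, factorization and resampling. -/

/-- The expectation of a function of labels that are independent with law `π`. -/
noncomputable def mean {V K : Type*} [Fintype V] [DecidableEq V] [Fintype K] (π : K → ℝ)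
    (F : (V → K) → ℝ) : ℝ :=
  ∑ σ : V → K, (∏ v, π (σ v)) * F σ

/-- The function `F` of the labels depends only on the labels of the vertices in `A`. -/
def IsLocalOn {V K : Type*} (F : (V → K) → ℝ) (A : Finset V) : Prop :=
  ∀ σ τ : V → K, (∀ v ∈ A, σ v = τ v) → F σ = F τ

section Local

variable {V K : Type*}

lemma IsLocalOn.mono {F : (V → K) → ℝ} {A B : Finset V} (h : IsLocalOn F A) (hAB : A ⊆ B) :
    IsLocalOn F B :=
  fun σ τ hst => h σ τ fun v hv => hst v (hAB hv)

lemma IsLocalOn.mul {F G : (V → K) → ℝ} {A : Finset V} (hF : IsLocalOn F A)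
    (hG : IsLocalOn G A) : IsLocalOn (fun σ => F σ * G σ) A :=
  fun σ τ hst => by simp only [hF σ τ hst, hG σ τ hst]

lemma IsLocalOn.prod {ι : Type*} {s : Finset ι} {F : ι → (V → K) → ℝ} {A : Finset V}
    (hF : ∀ i ∈ s, IsLocalOn (F i) A) : IsLocalOn (fun σ => ∏ i ∈ s, F i σ) A :=
  fun σ τ hst => Finset.prod_congr rfl fun i hi => hF i hi σ τ hst

lemma IsLocalOn.update [DecidableEq V] {F : (V → K) → ℝ} {A : Finset V} (hF : IsLocalOn F A) {w : V}
    (hw : w ∉ A) (σ : V → K) (k : K) : F (Function.update σ w k) = F σ :=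
  hF _ _ fun _ hv => Function.update_of_ne (ne_of_mem_of_not_mem hv hw) _ _

end Local

section Mean

variable {V K : Type*} [Fintype V] [DecidableEq V] [Fintype K] {π : K → ℝ}

lemma mean_prod (g : V → K → ℝ) :
    mean π (fun σ => ∏ v, g v (σ v)) = ∏ v, ∑ k, π k * g v k := by
  classical
  rw [Finset.prod_univ_sum, Fintype.piFinset_univ]
  simp [mean, Finset.prod_mul_distrib]

lemma mean_one (h : ∑ k, π k = 1) : mean (V := V) π (fun _ => 1) = 1 := by
  have := mean_prod (V := V) (π := π) (fun _ _ => 1)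
  simpa [h] using this

lemma mean_mul_left (c : ℝ) (F : (V → K) → ℝ) : mean π (fun σ => c * F σ) = c * mean π F := by
  simp only [mean, Finset.mul_sum]
  exact Finset.sum_congr rfl fun _ _ => by ring

lemma mean_mul_right (c : ℝ) (F : (V → K) → ℝ) : mean π (fun σ => F σ * c) = mean π F * c := by
  simp only [mean, Finset.sum_mul]
  exact Finset.sum_congr rfl fun _ _ => by ring

lemma mean_sum {ι : Type*} (s : Finset ι) (F : ι → (V → K) → ℝ) :
    mean π (fun σ => ∑ i ∈ s, F i σ) = ∑ i ∈ s, mean π (F i) := by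
  simp only [mean, Finset.mul_sum]
  exact Finset.sum_comm

lemma mean_mono (hπ : ∀ k, 0 ≤ π k) {F G : (V → K) → ℝ} (h : ∀ σ, F σ ≤ G σ) :
    mean π F ≤ mean π G :=
  Finset.sum_le_sum fun σ _ =>
    mul_le_mul_of_nonneg_left (h σ) (Finset.prod_nonneg fun _ _ => hπ _)

lemma mean_nonneg (hπ : ∀ k, 0 ≤ π k) {F : (V → K) → ℝ} (h : ∀ σ, 0 ≤ F σ) : 0 ≤ mean π F :=
  Finset.sum_nonneg fun σ _ => mul_nonneg (Finset.prod_nonneg fun _ _ => hπ _) (h σ)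

lemma abs_mean_le (hπ : ∀ k, 0 ≤ π k) (F : (V → K) → ℝ) :
    |mean π F| ≤ mean π (fun σ => |F σ|) := by
  refine (Finset.abs_sum_le_sum_abs _ _).trans_eq (Finset.sum_congr rfl fun σ _ => ?_)
  rw [abs_mul, abs_of_nonneg (Finset.prod_nonneg fun _ _ => hπ _)]

/-- Functions that depend on disjoint sets of vertices are independent. -/
lemma mean_mul_of_disjoint (h1 : ∑ k, π k = 1) {F G : (V → K) → ℝ} {A B : Finset V}
    (hF : IsLocalOn F A) (hG : IsLocalOn G B) (hAB : Disjoint A B) :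
    mean π (fun σ => F σ * G σ) = mean π F * mean π G := by
  classical
  have hswap : mean π F * mean π G =
      ∑ p : (V → K) × (V → K), ((∏ v, π (p.1 v)) * ∏ v, π (p.2 v)) * (F p.1 * G p.2) := by
    rw [mean, mean, Finset.sum_mul_sum, ← Finset.univ_product_univ, Finset.sum_product]
    exact Finset.sum_congr rfl fun _ _ => Finset.sum_congr rfl fun _ _ => by ring
  have hone : mean π (fun σ => F σ * G σ) =
      ∑ p : (V → K) × (V → K), ((∏ v, π (p.1 v)) * ∏ v, π (p.2 v)) * (F p.1 * G p.1) := by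
    rw [← mul_one (mean π _), ← mean_one (V := V) h1, mean, mean, Finset.sum_mul_sum,
      ← Finset.univ_product_univ, Finset.sum_product]
    exact Finset.sum_congr rfl fun _ _ => Finset.sum_congr rfl fun _ _ => by ring
  rw [hswap, hone]
  -- For two independent copies of the labels, exchanging those outside `A` preserves the weight. It
  -- does not affect `F` on the first copy, and it carries `G` on the first copy to `G` on the
  -- second.
  let sw : (V → K) × (V → K) → (V → K) × (V → K) := fun p =>
    (fun v => if v ∈ A then p.1 v else p.2 v, fun v => if v ∈ A then p.2 v else p.1 v)
  have hsw : Function.Involutive sw := by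
    intro p
    ext v <;> by_cases hv : v ∈ A <;> simp [sw, hv]
  refine Fintype.sum_equiv hsw.toPerm _ _ fun p => ?_
  simp only [Function.Involutive.coe_toPerm]
  have hw : (∏ v, π ((sw p).1 v)) * ∏ v, π ((sw p).2 v) =
      (∏ v, π (p.1 v)) * ∏ v, π (p.2 v) := by
    rw [← Finset.prod_mul_distrib, ← Finset.prod_mul_distrib]
    refine Finset.prod_congr rfl fun v _ => ?_
    by_cases hv : v ∈ A <;> simp [sw, hv, mul_comm]
  rw [hw]
  congr 2
  · exact hF _ _ fun v hv => by simp [sw, hv]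
  · exact hG _ _ fun v hv => by simp [sw, Finset.disjoint_right.1 hAB hv]

/-- The label of one vertex may be drawn afresh. -/
lemma mean_resample (h1 : ∑ k, π k = 1) (w : V) (F : (V → K) → ℝ) :
    mean π F = mean π (fun σ => ∑ k, π k * F (Function.update σ w k)) := by
  classical
  have hone : mean π F = ∑ p : (V → K) × K, ((∏ v, π (p.1 v)) * π p.2) * F p.1 := by
    rw [mean, ← Finset.univ_product_univ, Finset.sum_product]
    refine Finset.sum_congr rfl fun σ _ => ?_
    simp only [← Finset.sum_mul, ← Finset.mul_sum, h1, mul_one]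
  have htwo : mean π (fun σ => ∑ k, π k * F (Function.update σ w k)) =
      ∑ p : (V → K) × K, ((∏ v, π (p.1 v)) * π p.2) * F (Function.update p.1 w p.2) := by
    rw [mean, ← Finset.univ_product_univ, Finset.sum_product]
    refine Finset.sum_congr rfl fun σ _ => ?_
    rw [Finset.mul_sum]
    exact Finset.sum_congr rfl fun _ _ => by ring
  rw [hone, htwo]
  -- Exchanging the label of `w` with the fresh label preserves the product weight.
  let sw : (V → K) × K → (V → K) × K := fun p => (Function.update p.1 w p.2, p.1 w)
  have hsw : Function.Involutive sw := by
    intro p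
    simp [sw]
  refine Fintype.sum_equiv hsw.toPerm _ _ fun p => ?_
  simp only [Function.Involutive.coe_toPerm]
  have hw : (∏ v, π ((sw p).1 v)) * π (sw p).2 = (∏ v, π (p.1 v)) * π p.2 := by
    rw [← Finset.mul_prod_erase _ _ (Finset.mem_univ w),
      ← Finset.mul_prod_erase _ (fun v => π (p.1 v)) (Finset.mem_univ w)]
    have : ∏ v ∈ Finset.univ.erase w, π ((sw p).1 v) = ∏ v ∈ Finset.univ.erase w, π (p.1 v) :=
      Finset.prod_congr rfl fun v hv => by simp [sw, Finset.ne_of_mem_erase hv]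
    rw [this]
    simp only [sw, Function.update_self]
    ring
  rw [hw]
  simp [sw]

/-- A function of the labels in `B` times a product of functions of single labels: outside `B` the
factors are averaged separately. -/
lemma abs_mean_mul_prod_le (hπ : ∀ k, 0 ≤ π k) (h1 : ∑ k, π k = 1) {G : (V → K) → ℝ}
    {B : Finset V} (hG : IsLocalOn G B) (g : V → K → ℝ) (b : V → ℝ) (hb0 : ∀ v, 0 ≤ b v)
    (hB : ∀ v ∈ B, ∀ k, |g v k| ≤ b v) (hBc : ∀ v ∉ B, |∑ k, π k * g v k| ≤ b v) :
    |mean π (fun σ => G σ * ∏ v, g v (σ v))| ≤ mean π (fun σ => |G σ|) * ∏ v, b v := by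
  classical
  have hsplit : mean π (fun σ => G σ * ∏ v, g v (σ v)) =
      mean π (fun σ => G σ * ∏ v ∈ B, g v (σ v)) * ∏ v ∈ Bᶜ, ∑ k, π k * g v k := by
    have h2 : mean π (fun σ : V → K => ∏ v ∈ Bᶜ, g v (σ v)) = ∏ v ∈ Bᶜ, ∑ k, π k * g v k := by
      have := mean_prod (π := π) (fun v k => if v ∈ Bᶜ then g v k else 1)
      rw [Finset.prod_congr rfl (g := fun v => if v ∈ Bᶜ then ∑ k, π k * g v k else 1)] at this
      · simpa only [Fintype.prod_ite_mem] using this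
      · intro v _
        by_cases hv : v ∈ Bᶜ <;> simp only [hv, if_true, if_false, mul_one, h1]
    rw [← h2, ← mean_mul_of_disjoint h1 (A := B) (B := Bᶜ) _ _ disjoint_compl_right]
    · congr 1
      ext σ
      rw [mul_assoc, Finset.prod_mul_prod_compl]
    · exact hG.mul (IsLocalOn.prod fun v hv σ τ hst => by rw [hst v hv])
    · exact IsLocalOn.prod fun v hv σ τ hst => by rw [hst v hv]
  rw [hsplit, abs_mul, ← Finset.prod_mul_prod_compl B b, ← mul_assoc, Finset.abs_prod]
  refine mul_le_mul ?_ (Finset.prod_le_prod (fun _ _ => abs_nonneg _) fun v hv =>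
    hBc v (Finset.mem_compl.1 hv)) (Finset.prod_nonneg fun _ _ => abs_nonneg _)
    (mul_nonneg (mean_nonneg hπ fun _ => abs_nonneg _) (Finset.prod_nonneg fun _ _ => hb0 _))
  rw [← mean_mul_right]
  refine (abs_mean_le hπ _).trans (mean_mono hπ fun σ => ?_)
  rw [abs_mul, Finset.abs_prod]
  exact mul_le_mul_of_nonneg_left (Finset.prod_le_prod (fun _ _ => abs_nonneg _)
    fun v hv => hB v hv _) (abs_nonneg _)

end Mean

/-! ### Admissible graphs, excess and branch half-edges. -/

section Graph

variable {n : ℕ}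

/-- The vertex `w` is an endpoint of the pair `e`. -/
def Inc (w : Fin n) (e : Edge n) : Prop := e.1.1 = w ∨ e.1.2 = w

instance (w : Fin n) : DecidablePred (Inc w) :=
  fun e => inferInstanceAs (Decidable (e.1.1 = w ∨ e.1.2 = w))

/-- The degree of `w` in the graph with edge set `α`. -/
def deg (α : Finset (Edge n)) (w : Fin n) : ℕ := (α.filter (Inc w)).card

/-- The vertices that are not isolated in the graph with edge set `α`. -/
def verts (α : Finset (Edge n)) : Finset (Fin n) :=
  Finset.univ.filter fun w => ∃ e ∈ α, Inc w e

/-- The vertices of the graph with edge set `α`, together with the two roots `u` and `v`. -/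
def rootedVerts (u v : Fin n) (α : Finset (Edge n)) : Finset (Fin n) :=
  insert u (insert v (verts α))

/-- The number of vertices of `α` other than the roots. -/
def innerCount (u v : Fin n) (α : Finset (Edge n)) : ℕ := (verts α \ {u, v}).card

/-- The number of edges minus the number of vertices other than the roots. -/
def excess (u v : Fin n) (α : Finset (Edge n)) : ℕ := α.card - innerCount u v α

/-- The graphs that cover both roots, have no leaf except possibly the roots, and have no part that
is separated from the roots. -/
structure Admissible (u v : Fin n) (α : Finset (Edge n)) : Prop where
  left : u ∈ verts α
  right : v ∈ verts α
  leaf : ∀ w, w ≠ u → w ≠ v → deg α w ≠ 1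
  conn : ∀ γ ⊆ α, u ∉ verts γ → v ∉ verts γ → (∀ w ∈ verts γ, w ∉ verts (α \ γ)) → γ = ∅

lemma mem_verts {α : Finset (Edge n)} {w : Fin n} : w ∈ verts α ↔ ∃ e ∈ α, Inc w e := by
  simp [verts]

lemma mem_rootedVerts {u v w : Fin n} {α : Finset (Edge n)} :
    w ∈ rootedVerts u v α ↔ w = u ∨ w = v ∨ w ∈ verts α := by
  simp [rootedVerts]

lemma verts_mono {α β : Finset (Edge n)} (h : α ⊆ β) : verts α ⊆ verts β := by
  intro w hw
  obtain ⟨e, he, hwe⟩ := mem_verts.1 hw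
  exact mem_verts.2 ⟨e, h he, hwe⟩

lemma fst_mem_verts {α : Finset (Edge n)} {e : Edge n} (he : e ∈ α) : e.1.1 ∈ verts α :=
  mem_verts.2 ⟨e, he, Or.inl rfl⟩

lemma snd_mem_verts {α : Finset (Edge n)} {e : Edge n} (he : e ∈ α) : e.1.2 ∈ verts α :=
  mem_verts.2 ⟨e, he, Or.inr rfl⟩

lemma mem_verts_insert {β : Finset (Edge n)} {e : Edge n} {w : Fin n} :
    w ∈ verts (insert e β) ↔ Inc w e ∨ w ∈ verts β := by
  simp [mem_verts]

lemma card_inc (e : Edge n) : (Finset.univ.filter fun w => Inc w e).card = 2 := by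
  have : (Finset.univ.filter fun w => Inc w e) = {e.1.1, e.1.2} := by
    ext w
    simp [Inc, eq_comm]
  rw [this, Finset.card_pair e.2.ne]

lemma sum_deg (α : Finset (Edge n)) : ∑ w, deg α w = 2 * α.card := by
  simp only [deg, Finset.card_filter]
  rw [Finset.sum_comm]
  simp only [← Finset.card_filter, card_inc, Finset.sum_const, smul_eq_mul]
  ring

lemma eq_of_inc {e e' : Edge n} {a b : Fin n} (hab : a ≠ b) (ha : Inc a e) (hb : Inc b e)
    (ha' : Inc a e') (hb' : Inc b e') : e = e' := by
  have h := e.2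
  have h' := e'.2
  refine Subtype.ext (Prod.ext ?_ ?_) <;> simp only [Inc, Fin.ext_iff, Fin.lt_def, ne_eq] at * <;>
    omega

/-- The other endpoint of a pair. -/
def other (e : Edge n) (w : Fin n) : Fin n := if e.1.1 = w then e.1.2 else e.1.1

lemma other_ne (e : Edge n) (w : Fin n) : other e w ≠ w := by
  unfold other
  split_ifs with h
  · exact fun h' => e.2.ne (h.trans h'.symm)
  · exact h

lemma inc_other (e : Edge n) (w : Fin n) : Inc (other e w) e := by
  unfold other Inc
  split_ifs <;> simp

lemma eq_other {e : Edge n} {w b : Fin n} (hw : Inc w e) (hb : Inc b e) (h : b ≠ w) :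
    b = other e w := by
  unfold other Inc at *
  split_ifs with h1 <;> grind

lemma other_injOn (w : Fin n) : Set.InjOn (fun e : Edge n => other e w) {e | Inc w e} := by
  intro e he e' he' h
  simp only at h
  exact eq_of_inc (other_ne e w).symm he (inc_other e w) he' (h ▸ inc_other e' w)

lemma card_filter_inc_le (w : Fin n) (A : Finset (Fin n)) :
    (Finset.univ.filter fun e : Edge n => Inc w e ∧ other e w ∈ A).card ≤ A.card := by
  refine Finset.card_le_card_of_injOn (fun e => other e w) (fun e he => ?_) fun e he e' he' h => ?_
  · exact (Finset.mem_filter.1 he).2.2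
  · exact other_injOn w (Finset.mem_filter.1 he).2.1 (Finset.mem_filter.1 he').2.1 h

lemma deg_sdiff {u v w : Fin n} {α β : Finset (Edge n)} (hw : w ∉ rootedVerts u v β) :
    deg (α \ β) w = deg α w := by
  unfold deg
  congr 1
  ext e
  simp only [Finset.mem_filter, Finset.mem_sdiff]
  constructor
  · exact fun h => ⟨h.1.1, h.2⟩
  · exact fun h => ⟨⟨h.1, fun he => hw (mem_rootedVerts.2 (Or.inr (Or.inr
      (mem_verts.2 ⟨e, he, h.2⟩))))⟩, h.2⟩

lemma deg_pos_iff {α : Finset (Edge n)} {w : Fin n} : 0 < deg α w ↔ w ∈ verts α := by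
  simp [deg, Finset.card_pos, Finset.Nonempty, mem_verts]

/-- The half-edges of `α \ β` at the vertices of `β`, at the roots and at the branch vertices. -/
def branchDarts (u v : Fin n) (α β : Finset (Edge n)) : Finset (Fin n × Edge n) :=
  Finset.univ.filter fun p =>
    p.2 ∈ α \ β ∧ Inc p.1 p.2 ∧ (p.1 ∈ rootedVerts u v β ∨ 3 ≤ deg α p.1)

lemma card_branchDarts_eq_sum (u v : Fin n) (α β : Finset (Edge n)) :
    (branchDarts u v α β).card = ∑ w : Fin n,
      ((α \ β).filter fun e => Inc w e ∧ (w ∈ rootedVerts u v β ∨ 3 ≤ deg α w)).card := by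
  rw [Finset.card_eq_sum_card_fiberwise (f := Prod.fst) (t := Finset.univ) (by simp)]
  refine Finset.sum_congr rfl fun w _ => ?_
  refine Finset.card_bij (fun p _ => p.2) ?_ ?_ ?_
  · rintro ⟨x, e⟩ h
    simp only [branchDarts, Finset.mem_filter, Finset.mem_univ, true_and] at h ⊢
    obtain ⟨h, rfl⟩ := h
    exact h
  · rintro ⟨x, e⟩ h ⟨x', e'⟩ h' hee
    simp only [Finset.mem_filter] at h h' hee
    rw [h.2.trans h'.2.symm, hee]
  · intro e he
    refine ⟨(w, e), ?_, rfl⟩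
    simp only [branchDarts, Finset.mem_filter, Finset.mem_univ, true_and] at he ⊢
    exact ⟨he, trivial⟩

/-- Vertex by vertex, the counted half-edges plus 6 for each vertex new relative to `β` are at most
three times the degree in `α \ β`; the degrees sum to twice the number of edges. The 6 is what
degree two allows, where no half-edge is counted, and degree `g ≥ 3` satisfies `g + 6 ≤ 3 g`. New
leaves would break this; admissibility excludes them. -/
lemma card_branchDarts_le {u v : Fin n} {α β : Finset (Edge n)} (hα : Admissible u v α)
    (hβ : β ⊆ α) :
    (branchDarts u v α β).card + 6 * (innerCount u v α + β.card) ≤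
      6 * (α.card + innerCount u v β) := by
  have h2 : innerCount u v α = innerCount u v β + (verts α \ rootedVerts u v β).card := by
    unfold innerCount
    rw [← Finset.card_union_of_disjoint]
    · congr 1
      ext w
      have := @verts_mono _ _ _ hβ w
      simp only [Finset.mem_sdiff, Finset.mem_union, mem_rootedVerts, Finset.mem_insert,
        Finset.mem_singleton]
      tauto
    · rw [Finset.disjoint_left]
      intro w hw hw'
      simp only [Finset.mem_sdiff, mem_rootedVerts] at hw hw'
      tauto
  have h3 : ∀ w : Fin n,
      ((α \ β).filter fun e => Inc w e ∧ (w ∈ rootedVerts u v β ∨ 3 ≤ deg α w)).card +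
        6 * (if w ∈ verts α \ rootedVerts u v β then 1 else 0) ≤ 3 * deg (α \ β) w := by
    intro w
    by_cases hw : w ∈ rootedVerts u v β
    · have : ((α \ β).filter fun e => Inc w e ∧ (w ∈ rootedVerts u v β ∨ 3 ≤ deg α w)).card =
          deg (α \ β) w := by
        unfold deg
        congr 1
        ext e
        simp [hw]
      rw [this]
      simp only [hw, Finset.mem_sdiff, not_true, and_false, if_false]
      omega
    · rw [deg_sdiff hw]
      by_cases hw3 : 3 ≤ deg α w
      · simp only [hw3, or_true, and_true]
        have : ((α \ β).filter (Inc w)).card = deg α w := deg_sdiff hw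
        rw [this]
        split_ifs <;> omega
      · simp only [hw, hw3, or_self, and_false, Finset.filter_false, Finset.card_empty]
        split_ifs with hv
        · have := deg_pos_iff.2 (Finset.mem_sdiff.1 hv).1
          have := hα.leaf w (fun h => hw (mem_rootedVerts.2 (Or.inl h)))
            (fun h => hw (mem_rootedVerts.2 (Or.inr (Or.inl h))))
          omega
        · omega
  have h4 := Finset.sum_le_sum fun w (_ : w ∈ Finset.univ) => h3 w
  rw [Finset.sum_add_distrib, ← card_branchDarts_eq_sum, ← Finset.mul_sum, ← Finset.mul_sum, sum_deg,
    ← Finset.card_filter, Finset.filter_mem_eq_inter, Finset.univ_inter,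
    Finset.card_sdiff_of_subset hβ] at h4
  have := Finset.card_le_card hβ
  omega

/-- Otherwise no edge of `α \ β` touches `β` or a root, so `α \ β` is a part separated from the
roots. -/
lemma branchDarts_nonempty {u v : Fin n} {α β : Finset (Edge n)} (hα : Admissible u v α)
    (hβ : β ⊂ α) : (branchDarts u v α β).Nonempty := by
  rw [Finset.nonempty_iff_ne_empty]
  intro h0
  have hdart : ∀ w ∈ verts (α \ β), w ∉ rootedVerts u v β := by
    intro w hw hwβ
    obtain ⟨e, he, hwe⟩ := mem_verts.1 hw
    have : (w, e) ∈ branchDarts u v α β := by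
      simp only [branchDarts, Finset.mem_filter, Finset.mem_univ, true_and]
      exact ⟨he, hwe, Or.inl hwβ⟩
    simp [h0] at this
  have := hα.conn (α \ β) Finset.sdiff_subset
    (fun h => hdart _ h (mem_rootedVerts.2 (Or.inl rfl)))
    (fun h => hdart _ h (mem_rootedVerts.2 (Or.inr (Or.inl rfl)))) fun w hw hw' => by
      rw [Finset.sdiff_sdiff_eq_self hβ.1] at hw'
      exact hdart w hw (mem_rootedVerts.2 (Or.inr (Or.inr hw')))
  exact hβ.2 (Finset.sdiff_eq_empty_iff_subset.1 this)

/-- Lets sums over subgraphs be replaced by sums over sets of half-edges. If `β` and `β'` give the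
same set, no edge of `β' \ β` meets a root, a vertex of `β` or a branch vertex, and any edge of `α`
adjacent to `β' \ β` lies in it again. So `β' \ β` is separated from the roots, hence empty. -/
lemma branchDarts_injOn {u v : Fin n} {α : Finset (Edge n)} (hα : Admissible u v α) :
    Set.InjOn (branchDarts u v α) {β | β ⊆ α} := by
  have key : ∀ β β' : Finset (Edge n), β' ⊆ α →
      branchDarts u v α β = branchDarts u v α β' → β' ⊆ β := by
    intro β β' hβ' h
    have hmem : ∀ w e, (e ∈ α \ β ∧ Inc w e ∧ (w ∈ rootedVerts u v β ∨ 3 ≤ deg α w)) ↔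
        (e ∈ α \ β' ∧ Inc w e ∧ (w ∈ rootedVerts u v β' ∨ 3 ≤ deg α w)) := by
      intro w e
      have := congrArg ((w, e) ∈ ·) h
      simpa [branchDarts] using this
    have hns : ∀ e ∈ β' \ β, ∀ w, Inc w e → ¬ (w ∈ rootedVerts u v β ∨ 3 ≤ deg α w) := by
      intro e he w hwe hs
      obtain ⟨he', heβ⟩ := Finset.mem_sdiff.1 he
      exact (Finset.mem_sdiff.1 ((hmem w e).1
        ⟨Finset.mem_sdiff.2 ⟨hβ' he', heβ⟩, hwe, hs⟩).1).2 he'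
    refine Finset.sdiff_eq_empty_iff_subset.1
      (hα.conn (β' \ β) (Finset.sdiff_subset.trans hβ') ?_ ?_ ?_)
    · intro hu
      obtain ⟨e, he, hwe⟩ := mem_verts.1 hu
      exact hns e he _ hwe (Or.inl (mem_rootedVerts.2 (Or.inl rfl)))
    · intro hu
      obtain ⟨e, he, hwe⟩ := mem_verts.1 hu
      exact hns e he _ hwe (Or.inl (mem_rootedVerts.2 (Or.inr (Or.inl rfl))))
    · intro w hw hw'
      obtain ⟨e, he, hwe⟩ := mem_verts.1 hw
      obtain ⟨e', he', hwe'⟩ := mem_verts.1 hw'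
      have hnw := hns e he w hwe
      have he'β : e' ∉ β := fun h => hnw (Or.inl (mem_rootedVerts.2 (Or.inr (Or.inr
        (mem_verts.2 ⟨e', h, hwe'⟩)))))
      obtain ⟨he'α, he'd⟩ := Finset.mem_sdiff.1 he'
      have he'β' : e' ∉ β' := fun h => he'd (Finset.mem_sdiff.2 ⟨h, he'β⟩)
      exact hnw ((hmem w e').2 ⟨Finset.mem_sdiff.2 ⟨he'α, he'β'⟩, hwe',
        Or.inl (mem_rootedVerts.2 (Or.inr (Or.inr
          (mem_verts.2 ⟨e, (Finset.mem_sdiff.1 he).1, hwe⟩))))⟩).2.2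
  intro β hβ β' hβ' h
  exact Finset.Subset.antisymm (key β' β hβ h.symm) (key β β' hβ' h)

/-- Ensures that the truncated subtraction in `excess` is a true one. -/
lemma innerCount_le_card {u v : Fin n} {α : Finset (Edge n)} (hα : Admissible u v α) :
    innerCount u v α ≤ α.card := by
  have := card_branchDarts_le hα (Finset.empty_subset α)
  simp [innerCount, verts] at this ⊢
  omega

lemma card_branchDarts_le_excess {u v : Fin n} {α β : Finset (Edge n)} (hα : Admissible u v α)
    (hβ : Admissible u v β) (h : β ⊆ α) :
    (branchDarts u v α β).card + 6 * excess u v β ≤ 6 * excess u v α := by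
  have := card_branchDarts_le hα h
  have := innerCount_le_card hα
  have := innerCount_le_card hβ
  unfold excess
  omega

lemma card_branchDarts_empty_le {u v : Fin n} {α : Finset (Edge n)} (hα : Admissible u v α) :
    (branchDarts u v α ∅).card ≤ 6 * excess u v α := by
  have := card_branchDarts_le hα (Finset.empty_subset α)
  have h0 : innerCount u v (∅ : Finset (Edge n)) = 0 := by simp [innerCount, verts]
  rw [h0, Finset.card_empty] at this
  unfold excess
  omega

lemma excess_lt {u v : Fin n} {α β : Finset (Edge n)} (hα : Admissible u v α)
    (hβ : Admissible u v β) (h : β ⊂ α) : excess u v β < excess u v α := by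
  have := card_branchDarts_le_excess hα hβ h.1
  have := (branchDarts_nonempty hα h).card_pos
  omega

/-- The empty subgraph already leaves a branch half-edge, and there are at most six per unit of
excess. This is where the factor `1 / n` originates. -/
lemma excess_pos {u v : Fin n} {α : Finset (Edge n)} (hα : Admissible u v α) :
    0 < excess u v α := by
  have := card_branchDarts_empty_le hα
  have hne : α ≠ ∅ := by
    rintro rfl
    simpa [verts] using hα.left
  have := (branchDarts_nonempty hα (Finset.empty_ssubset.2
    (Finset.nonempty_iff_ne_empty.2 hne))).card_pos
  omega

lemma excess_le_card {u v : Fin n} {α : Finset (Edge n)} : excess u v α ≤ α.card :=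
  Nat.sub_le _ _

end Graph

/-! ### Exploration of admissible graphs and their enumeration. -/

section Growth

variable {n : ℕ}

/-- Graphs grown edge by edge from the root `u`, each edge being attached to the current position.
An edge to a vertex not seen before moves the position there; an edge to a vertex seen before raises
the counter, and the position then jumps anywhere. -/
inductive Grown (u v : Fin n) : Finset (Edge n) → Fin n → ℕ → Prop
  | start : Grown u v ∅ u 0
  -- `rootedVerts` contains both roots from the start, so even the first arrival at `v` is a closing
  -- step.
  | new {β : Finset (Edge n)} {h b : Fin n} {k : ℕ} {e : Edge n} (hg : Grown u v β h k)
      (hh : Inc h e) (hb : Inc b e) (hbβ : b ∉ rootedVerts u v β) : Grown u v (insert e β) b k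
  | close {β : Finset (Edge n)} {h c : Fin n} {k : ℕ} {e : Edge n} (hg : Grown u v β h k)
      (he : e ∉ β) (hh : Inc h e) (ho : other e h ∈ rootedVerts u v β)
      (hc : c ∈ rootedVerts u v β) : Grown u v (insert e β) c (k + 1)

lemma Grown.position_mem {u v h : Fin n} {β : Finset (Edge n)} {k : ℕ} (hg : Grown u v β h k) :
    h ∈ rootedVerts u v β := by
  cases hg with
  | start => simp [rootedVerts]
  | new hg hh hb hbβ => exact mem_rootedVerts.2 (Or.inr (Or.inr (mem_verts_insert.2 (Or.inl hb))))
  | close hg he hh ho hc =>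
    rw [mem_rootedVerts] at hc ⊢
    rw [mem_verts_insert]
    tauto

lemma not_mem_of_not_mem_verts {β : Finset (Edge n)} {e : Edge n} {b u v : Fin n} (hb : Inc b e)
    (hbβ : b ∉ rootedVerts u v β) : e ∉ β := fun he =>
  hbβ (mem_rootedVerts.2 (Or.inr (Or.inr (mem_verts.2 ⟨e, he, hb⟩))))

/-- A step to a new vertex adds one edge and one inner vertex, a closing step only an edge; so the
counter is the excess. -/
lemma Grown.card_eq {u v h : Fin n} {β : Finset (Edge n)} {k : ℕ} (hg : Grown u v β h k) :
    β.card = innerCount u v β + k := by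
  induction hg with
  | start => simp [innerCount, verts]
  | @new β h b k e hg hh hb hbβ ih =>
    have hbh : b ≠ h := fun hbh => hbβ (hbh ▸ hg.position_mem)
    have : verts (insert e β) \ {u, v} = insert b (verts β \ {u, v}) := by
      ext w
      have hw : Inc w e ↔ w = h ∨ w = b := by
        constructor
        · intro hw
          by_contra! hne
          exact hne.2 ((eq_other hh hw hne.1).trans (eq_other hh hb hbh).symm)
        · rintro (rfl | rfl) <;> assumption
      have hpos := mem_rootedVerts.1 hg.position_mem
      rw [mem_rootedVerts] at hbβ
      simp only [Finset.mem_sdiff, Finset.mem_insert, mem_verts_insert, Finset.mem_singleton, hw]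
      by_cases hwh : w = h
      · subst hwh
        tauto
      · by_cases hwb : w = b
        · subst hwb
          tauto
        · tauto
    have hb2 : b ∉ verts β \ {u, v} := fun h => hbβ (mem_rootedVerts.2 (Or.inr (Or.inr
      (Finset.mem_sdiff.1 h).1)))
    rw [innerCount, this, Finset.card_insert_of_notMem hb2,
      Finset.card_insert_of_notMem (not_mem_of_not_mem_verts hb hbβ), ih, innerCount]
    ring
  | @close β h c k e hg he hh ho hc ih =>
    have : verts (insert e β) \ {u, v} = verts β \ {u, v} := by
      ext w
      have hw : Inc w e → w = u ∨ w = v ∨ w ∈ verts β := by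
        intro hw
        by_cases hwh : w = h
        · exact hwh ▸ mem_rootedVerts.1 hg.position_mem
        · exact eq_other hh hw hwh ▸ mem_rootedVerts.1 ho
      simp only [Finset.mem_sdiff, Finset.mem_insert, mem_verts_insert, Finset.mem_singleton]
      tauto
    rw [Finset.card_insert_of_notMem he, ih, innerCount, innerCount, this]
    ring

lemma Grown.excess_eq {u v h : Fin n} {β : Finset (Edge n)} {k : ℕ} (hg : Grown u v β h k) :
    excess u v β = k := by
  rw [excess, hg.card_eq, Nat.add_sub_cancel_left]

/-- The root `v` can be reached only by a closing step, and none has occurred. -/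
lemma Grown.right_not_mem {u v h : Fin n} (huv : u ≠ v) {β : Finset (Edge n)}
    (hg : Grown u v β h 0) : v ∉ verts β ∧ h ≠ v := by
  generalize hk : 0 = k at hg
  induction hg with
  | start => simpa [verts] using huv
  | @new β h b k e hg hh hb hbβ ih =>
    obtain ⟨ih1, ih2⟩ := ih hk
    have hbv : b ≠ v := fun h => hbβ (mem_rootedVerts.2 (Or.inr (Or.inl h)))
    have hbh : b ≠ h := fun hbh => hbβ (hbh ▸ hg.position_mem)
    refine ⟨fun h' => ?_, hbv⟩
    rcases mem_verts_insert.1 h' with h' | h'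
    · exact hbv ((eq_other hh hb hbh).trans (eq_other hh h' ih2.symm).symm)
    · exact ih1 h'
  | close => omega

/-- Every admissible graph can be grown. -/
lemma Admissible.exists_grown {u v : Fin n} {α : Finset (Edge n)} (hα : Admissible u v α) (i : ℕ)
    (hi : i ≤ α.card) : ∃ β h k, Grown u v β h k ∧ β ⊆ α ∧ β.card = i ∧
      (β = α ∨ ∃ e ∈ α \ β, Inc h e) := by
  induction i with
  | zero =>
    obtain ⟨e, he, hue⟩ := mem_verts.1 hα.left
    exact ⟨∅, u, 0, Grown.start, Finset.empty_subset _, rfl, Or.inr ⟨e, by simpa using he, hue⟩⟩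
  | succ i ih =>
    obtain ⟨β, h, k, hg, hβα, hcard, hor⟩ := ih (by omega)
    have hne : β ≠ α := by
      rintro rfl
      omega
    obtain ⟨e, he, hhe⟩ := hor.resolve_left hne
    obtain ⟨heα, heβ⟩ := Finset.mem_sdiff.1 he
    have hsub : insert e β ⊆ α := Finset.insert_subset heα hβα
    have hcard' : (insert e β).card = i + 1 := by rw [Finset.card_insert_of_notMem heβ, hcard]
    by_cases ho : other e h ∈ rootedVerts u v β
    · by_cases heq : insert e β = α
      · exact ⟨insert e β, h, k + 1, hg.close heβ hhe ho hg.position_mem, hsub, hcard',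
          Or.inl heq⟩
      -- After closing, some explored vertex or root still has an unexplored edge; otherwise the
      -- remaining edges would be separated from the roots.
      · have : ∃ c ∈ rootedVerts u v β, ∃ f ∈ α \ insert e β, Inc c f := by
          by_contra! hcon
          have h0 := hα.conn (α \ insert e β) Finset.sdiff_subset ?_ ?_ ?_
          · exact heq (Finset.Subset.antisymm hsub (Finset.sdiff_eq_empty_iff_subset.1 h0))
          · intro hu
            obtain ⟨f, hf, huf⟩ := mem_verts.1 hu
            exact hcon u (mem_rootedVerts.2 (Or.inl rfl)) f hf huf
          · intro hu
            obtain ⟨f, hf, huf⟩ := mem_verts.1 hu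
            exact hcon v (mem_rootedVerts.2 (Or.inr (Or.inl rfl))) f hf huf
          · intro w hw hw'
            rw [Finset.sdiff_sdiff_eq_self hsub] at hw'
            obtain ⟨f, hf, hwf⟩ := mem_verts.1 hw
            refine hcon w ?_ f hf hwf
            rcases mem_verts_insert.1 hw' with h1 | h1
            · by_cases hwh : w = h
              · exact hwh ▸ hg.position_mem
              · exact eq_other hhe h1 hwh ▸ ho
            · exact mem_rootedVerts.2 (Or.inr (Or.inr h1))
        obtain ⟨c, hc, f, hf, hcf⟩ := this
        exact ⟨insert e β, c, k + 1, hg.close heβ hhe ho hc, hsub, hcard', Or.inr ⟨f, hf, hcf⟩⟩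
    -- The new vertex is not a leaf of `α`, so an unexplored edge leaves it and no jump is needed.
    · refine ⟨insert e β, other e h, k, hg.new hhe (inc_other e h) ho, hsub, hcard', Or.inr ?_⟩
      have hpos : 0 < deg α (other e h) :=
        deg_pos_iff.2 (mem_verts.2 ⟨e, heα, inc_other e h⟩)
      have hone := hα.leaf (other e h) (fun h' => ho (mem_rootedVerts.2 (Or.inl h')))
        (fun h' => ho (mem_rootedVerts.2 (Or.inr (Or.inl h'))))
      have hlt : 1 < (α.filter (Inc (other e h))).card := by
        have : deg α (other e h) = (α.filter (Inc (other e h))).card := rfl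
        omega
      obtain ⟨f, hf, hfe⟩ := Finset.exists_mem_ne hlt e
      obtain ⟨hfα, hfi⟩ := Finset.mem_filter.1 hf
      refine ⟨f, Finset.mem_sdiff.2 ⟨hfα, fun hfβ => ?_⟩, hfi⟩
      rcases Finset.mem_insert.1 hfβ with h1 | h1
      · exact hfe h1
      · exact not_mem_of_not_mem_verts hfi ho h1

lemma Admissible.grown {u v : Fin n} {α : Finset (Edge n)} (hα : Admissible u v α) :
    ∃ h, Grown u v α h (excess u v α) := by
  obtain ⟨β, h, k, hg, hβα, hcard, -⟩ := hα.exists_grown α.card le_rfl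
  obtain rfl := Finset.eq_of_subset_of_card_le hβα hcard.ge
  exact ⟨h, hg.excess_eq ▸ hg⟩

/-- An admissible graph of excess one arises from a graph of excess zero by an edge to `v`. -/
lemma Admissible.exists_grown_of_excess_eq_one {u v : Fin n} (huv : u ≠ v) {α : Finset (Edge n)}
    (hα : Admissible u v α) (h1 : excess u v α = 1) :
    ∃ β h e, Grown u v β h 0 ∧ β.card + 1 = α.card ∧ h ≠ v ∧ Inc h e ∧ Inc v e ∧
      α = insert e β := by
  obtain ⟨h, hg⟩ := hα.grown
  rw [h1] at hg
  generalize hk : 1 = k at hg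
  cases hg with
  | start => omega
  | @new β h₀ _ k e hg hh hb hbβ =>
    -- The last step cannot reach a new vertex, which would be a leaf. So it is the single closing
    -- step, and it must be the one that covers `v`.
    exfalso
    refine hα.leaf h (fun h' => hbβ (mem_rootedVerts.2 (Or.inl h')))
        (fun h' => hbβ (mem_rootedVerts.2 (Or.inr (Or.inl h')))) ?_
    rw [deg, Finset.card_eq_one]
    refine ⟨e, ?_⟩
    ext f
    simp only [Finset.mem_filter, Finset.mem_insert, Finset.mem_singleton]
    constructor
    · rintro ⟨h1 | h1, h2⟩
      · exact h1
      · exact absurd h1 (not_mem_of_not_mem_verts h2 hbβ)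
    · rintro rfl
      exact ⟨Or.inl rfl, hb⟩
  | @close β h c k e hg he hh ho hc =>
    obtain rfl : k = 0 := by omega
    obtain ⟨hv, hhv⟩ := hg.right_not_mem huv
    exact ⟨β, h, e, hg, (Finset.card_insert_of_notMem he).symm, hhv, hh,
      (mem_verts_insert.1 hα.right).resolve_right hv, rfl⟩

open Classical in
/-- The graphs with `i` edges grown with counter `k`, with the final position. -/
noncomputable def grownSet (u v : Fin n) (i k : ℕ) : Finset (Finset (Edge n) × Fin n) :=
  Finset.univ.filter fun p => p.1.card = i ∧ Grown u v p.1 p.2 k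

lemma mem_grownSet {u v : Fin n} {i k : ℕ} {p : Finset (Edge n) × Fin n} :
    p ∈ grownSet u v i k ↔ p.1.card = i ∧ Grown u v p.1 p.2 k := by
  simp [grownSet]

lemma card_rootedVerts_le {u v h : Fin n} {β : Finset (Edge n)} {k : ℕ}
    (hg : Grown u v β h k) : (rootedVerts u v β).card ≤ β.card + 2 := by
  have h1 : rootedVerts u v β ⊆ (verts β \ {u, v}) ∪ {u, v} := by
    intro w hw
    simp only [mem_rootedVerts, Finset.mem_union, Finset.mem_sdiff, Finset.mem_insert,
      Finset.mem_singleton] at *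
    tauto
  have h2 := (Finset.card_le_card h1).trans (Finset.card_union_le _ _)
  have h3 : ({u, v} : Finset (Fin n)).card ≤ 2 := Finset.card_le_two
  have h4 := hg.card_eq
  unfold innerCount at h4
  omega

open Classical in
lemma grownSet_succ_subset (u v : Fin n) (i k : ℕ) :
    grownSet u v (i + 1) k ⊆
      (grownSet u v i k).biUnion (fun p => (Finset.univ.filter fun e : Edge n =>
          Inc p.2 e ∧ other e p.2 ∈ Finset.univ).image fun e => (insert e p.1, other e p.2)) ∪
      (if k = 0 then ∅ else (grownSet u v i (k - 1)).biUnion (fun p =>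
        ((Finset.univ.filter fun e : Edge n => Inc p.2 e ∧
          other e p.2 ∈ rootedVerts u v p.1) ×ˢ rootedVerts u v p.1).image
            fun ec => (insert ec.1 p.1, ec.2))) := by
  rintro ⟨β', h'⟩ hp
  obtain ⟨hcard, hg⟩ := mem_grownSet.1 hp
  simp only at hcard hg
  rw [Finset.mem_union]
  cases hg with
  | start => simp at hcard
  | @new β h b k e hg hh hb hbβ =>
    left
    rw [Finset.card_insert_of_notMem (not_mem_of_not_mem_verts hb hbβ)] at hcard
    have hbh : h' ≠ h := fun hbh => hbβ (hbh ▸ hg.position_mem)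
    refine Finset.mem_biUnion.2 ⟨(β, h), mem_grownSet.2 ⟨by simpa using hcard, hg⟩, ?_⟩
    refine Finset.mem_image.2 ⟨e, by simpa using hh, ?_⟩
    simp only [eq_other hh hb hbh]
  | @close β h c k e hg he hh ho hc =>
    right
    rw [Finset.card_insert_of_notMem he] at hcard
    rw [if_neg (Nat.succ_ne_zero k), Nat.add_sub_cancel]
    refine Finset.mem_biUnion.2 ⟨(β, h), mem_grownSet.2 ⟨by simpa using hcard, hg⟩, ?_⟩
    refine Finset.mem_image.2 ⟨(e, h'), ?_, rfl⟩
    simp only [Finset.mem_product, Finset.mem_filter, Finset.mem_univ, true_and]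
    exact ⟨⟨hh, ho⟩, hc⟩

lemma card_grownSet_succ_zero (u v : Fin n) (i : ℕ) :
    (grownSet u v (i + 1) 0).card ≤ (grownSet u v i 0).card * n := by
  classical
  refine (Finset.card_le_card (grownSet_succ_subset u v i 0)).trans ?_
  rw [if_pos rfl, Finset.union_empty]
  refine Finset.card_biUnion_le_card_mul _ _ _ fun p _ => ?_
  refine Finset.card_image_le.trans ((card_filter_inc_le _ _).trans (by simp))

/-- The closing step chooses the vertex it closes at and the next position, each among at most `i +
2` rooted vertices. -/
lemma card_grownSet_succ_succ (u v : Fin n) (i k : ℕ) :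
    (grownSet u v (i + 1) (k + 1)).card ≤
      (grownSet u v i (k + 1)).card * n + (grownSet u v i k).card * (i + 2) ^ 2 := by
  classical
  refine (Finset.card_le_card (grownSet_succ_subset u v i (k + 1))).trans ?_
  rw [if_neg (Nat.succ_ne_zero k), Nat.add_sub_cancel]
  refine (Finset.card_union_le _ _).trans (add_le_add ?_ ?_)
  · refine Finset.card_biUnion_le_card_mul _ _ _ fun p _ => ?_
    refine Finset.card_image_le.trans ((card_filter_inc_le _ _).trans (by simp))
  · refine Finset.card_biUnion_le_card_mul _ _ _ fun p hp => ?_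
    obtain ⟨hcard, hg⟩ := mem_grownSet.1 hp
    have := card_rootedVerts_le hg
    rw [hcard] at this
    refine Finset.card_image_le.trans ?_
    rw [Finset.card_product, sq]
    exact Nat.mul_le_mul ((card_filter_inc_le _ _).trans this) this

lemma card_grownSet_zero_le (u v : Fin n) (i : ℕ) : (grownSet u v i 0).card ≤ n ^ i := by
  induction i with
  | zero =>
    rw [pow_zero, Finset.card_le_one]
    have : ∀ p ∈ grownSet u v 0 0, p = (∅, u) := by
      rintro ⟨β, h⟩ hp
      obtain ⟨hcard, hg⟩ := mem_grownSet.1 hp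
      simp only at hcard hg
      cases hg with
      | start => rfl
      | new => simp at hcard
    intro a ha b hb
    rw [this a ha, this b hb]
  | succ i ih =>
    exact (card_grownSet_succ_zero u v i).trans (pow_succ n i ▸ Nat.mul_le_mul_right n ih)

/-- Pascal's rule: the binomial coefficient chooses which `k` of the `i` steps close. -/
lemma card_grownSet_le (u v : Fin n) {D i : ℕ} (hi : i ≤ D) (k : ℕ) :
    (grownSet u v i k).card * n ^ k ≤ i.choose k * (n ^ i * (D + 2) ^ (2 * k)) := by
  induction i generalizing k with
  | zero =>
    cases k with
    | zero => simpa using card_grownSet_zero_le u v 0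
    | succ k =>
      have : grownSet u v 0 (k + 1) = ∅ := by
        rw [Finset.eq_empty_iff_forall_notMem]
        rintro ⟨β, h⟩ hp
        obtain ⟨hcard, hg⟩ := mem_grownSet.1 hp
        simp only at hcard hg
        cases hg with
        | new => simp at hcard
        | close => simp at hcard
      simp [this]
  | succ i ih =>
    cases k with
    | zero => simpa using card_grownSet_zero_le u v (i + 1)
    | succ k =>
      have h1 := ih (by omega) (k + 1)
      have h2 := ih (by omega) k
      have h3 : (i + 2) ^ 2 ≤ (D + 2) ^ 2 := Nat.pow_le_pow_left (by omega) 2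
      calc (grownSet u v (i + 1) (k + 1)).card * n ^ (k + 1)
          ≤ ((grownSet u v i (k + 1)).card * n + (grownSet u v i k).card * (i + 2) ^ 2) *
              n ^ (k + 1) := Nat.mul_le_mul_right _ (card_grownSet_succ_succ u v i k)
        _ = ((grownSet u v i (k + 1)).card * n ^ (k + 1)) * n +
              ((grownSet u v i k).card * n ^ k) * ((i + 2) ^ 2 * n) := by ring
        _ ≤ (i.choose (k + 1) * (n ^ i * (D + 2) ^ (2 * (k + 1)))) * n +
              (i.choose k * (n ^ i * (D + 2) ^ (2 * k))) * ((D + 2) ^ 2 * n) := by gcongr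
        _ = (i + 1).choose (k + 1) * (n ^ (i + 1) * (D + 2) ^ (2 * (k + 1))) := by
            rw [Nat.choose_succ_succ]
            ring

open Classical in
/-- The admissible graphs with `i` edges and excess `k`. -/
noncomputable def admissibleSet (u v : Fin n) (i k : ℕ) : Finset (Finset (Edge n)) :=
  Finset.univ.filter fun α => Admissible u v α ∧ α.card = i ∧ excess u v α = k

lemma mem_admissibleSet {u v : Fin n} {i k : ℕ} {α : Finset (Edge n)} :
    α ∈ admissibleSet u v i k ↔ Admissible u v α ∧ α.card = i ∧ excess u v α = k := by
  simp [admissibleSet]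

lemma card_admissibleSet_le (u v : Fin n) {D i : ℕ} (hi : i ≤ D) (k : ℕ) :
    (admissibleSet u v i k).card * n ^ k ≤ n ^ i * (D + 2) ^ (3 * k) := by
  have h1 : (admissibleSet u v i k).card ≤ (grownSet u v i k).card := by
    classical
    refine (Finset.card_le_card (t := (grownSet u v i k).image Prod.fst) fun α hα => ?_).trans
      Finset.card_image_le
    obtain ⟨hα, hcard, hk⟩ := mem_admissibleSet.1 hα
    obtain ⟨h, hg⟩ := hα.grown
    exact Finset.mem_image.2 ⟨(α, h), mem_grownSet.2 ⟨hcard, hk ▸ hg⟩, rfl⟩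
  have h2 : i.choose k ≤ (D + 2) ^ k :=
    (Nat.choose_le_pow i k).trans (Nat.pow_le_pow_left (by omega) k)
  calc (admissibleSet u v i k).card * n ^ k
      ≤ (grownSet u v i k).card * n ^ k := Nat.mul_le_mul_right _ h1
    _ ≤ i.choose k * (n ^ i * (D + 2) ^ (2 * k)) := card_grownSet_le u v hi k
    _ ≤ (D + 2) ^ k * (n ^ i * (D + 2) ^ (2 * k)) := Nat.mul_le_mul_right _ h2
    _ = n ^ i * (D + 2) ^ (3 * k) := by ring

/-- The only closing edge joins the last position to `v`, so the preceding growth determines the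
graph. The absence of powers of `D` is essential here, as excess one gives the main term. -/
lemma card_admissibleSet_one_le {u v : Fin n} (huv : u ≠ v) (i : ℕ) :
    (admissibleSet u v (i + 1) 1).card ≤ n ^ i := by
  classical
  refine le_trans ?_ (card_grownSet_zero_le u v i)
  refine (Finset.card_le_card (t := (grownSet u v i 0).image fun p =>
    (Finset.univ.filter fun e => Inc p.2 e ∧ Inc v e) ∪ p.1) fun α hα => ?_).trans
      Finset.card_image_le
  obtain ⟨hα, hcard, hk⟩ := mem_admissibleSet.1 hα
  obtain ⟨β, h, e, hg, hβ, hhv, hhe, hve, rfl⟩ := hα.exists_grown_of_excess_eq_one huv hk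
  refine Finset.mem_image.2 ⟨(β, h), mem_grownSet.2 ⟨by simpa using hβ.trans hcard, hg⟩, ?_⟩
  ext f
  simp only [Finset.mem_union, Finset.mem_filter, Finset.mem_univ, true_and, Finset.mem_insert]
  constructor
  · rintro (hf | hf)
    · exact Or.inl (eq_of_inc hhv hf.1 hf.2 hhe hve)
    · exact Or.inr hf
  · rintro (rfl | hf)
    · exact Or.inl ⟨hhe, hve⟩
    · exact Or.inr hf

end Growth

/-! ### Moments of a kernel over the edges of a graph. -/

section Kernel

variable {n : ℕ} {K I : Type*} [Fintype K]

lemma prod_inc {n : ℕ} (e : Edge n) (f : Fin n → ℝ) :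
    ∏ w ∈ Finset.univ.filter (fun w => Inc w e), f w = f e.1.1 * f e.1.2 := by
  have : (Finset.univ.filter fun w => Inc w e) = {e.1.1, e.1.2} := by
    ext w
    simp [Inc, eq_comm]
  rw [this, Finset.prod_pair e.2.ne]

/-- The colourings of the edges of `α \ β` that are constant around the vertices of degree two
outside `β`. -/
def Consistent (u v : Fin n) (α β : Finset (Edge n)) (ι : Edge n → I) : Prop :=
  ∀ w, w ∉ rootedVerts u v β → deg α w < 3 →
    ∀ e ∈ α \ β, ∀ e' ∈ α \ β, Inc w e → Inc w e' → ι e = ι e'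

-- A consistent colouring is determined by its values on the branch half-edges: the edges where two
-- such colourings differ avoid roots, vertices of `β` and branch vertices, and consistency
-- propagates the difference through vertices of degree two. They form a separated part, hence none
-- exist.
open Classical in
lemma card_consistent_le [Fintype I] {u v : Fin n} {α β : Finset (Edge n)} (hα : Admissible u v α) (i₀ : I)
    (Λ : Finset (Edge n → I)) (hΛ : ∀ ι ∈ Λ, ∀ e, e ∉ α \ β → ι e = i₀) :
    (Λ.filter (Consistent u v α β)).card ≤
      Fintype.card I ^ (branchDarts u v α β).card := by
  rw [show Fintype.card I ^ (branchDarts u v α β).card =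
    (Finset.univ : Finset (branchDarts u v α β → I)).card by simp]
  refine Finset.card_le_card_of_injOn (fun ι p => ι p.1.2) (by simp) ?_
  intro ι hι ι' hι' h
  simp only [Finset.coe_filter, Set.mem_ofPred_eq] at hι hι'
  have hagree : ∀ w, ∀ e ∈ α \ β, Inc w e → (w ∈ rootedVerts u v β ∨ 3 ≤ deg α w) →
      ι e = ι' e := by
    intro w e he hwe hs
    have hm : (w, e) ∈ branchDarts u v α β := by
      simp only [branchDarts, Finset.mem_filter, Finset.mem_univ, true_and]
      exact ⟨he, hwe, hs⟩
    exact congrFun h ⟨(w, e), hm⟩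
  have hδ : (α \ β).filter (fun e => ι e ≠ ι' e) = ∅ := by
    have hns : ∀ e ∈ (α \ β).filter (fun e => ι e ≠ ι' e), ∀ w, Inc w e →
        ¬ (w ∈ rootedVerts u v β ∨ 3 ≤ deg α w) := by
      intro e he w hwe hs
      obtain ⟨he1, he2⟩ := Finset.mem_filter.1 he
      exact he2 (hagree w e he1 hwe hs)
    refine hα.conn _ ((Finset.filter_subset _ _).trans Finset.sdiff_subset) ?_ ?_ ?_
    · intro hu
      obtain ⟨e, he, hwe⟩ := mem_verts.1 hu
      exact hns e he _ hwe (Or.inl (mem_rootedVerts.2 (Or.inl rfl)))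
    · intro hu
      obtain ⟨e, he, hwe⟩ := mem_verts.1 hu
      exact hns e he _ hwe (Or.inl (mem_rootedVerts.2 (Or.inr (Or.inl rfl))))
    · intro w hw hw'
      obtain ⟨e, he, hwe⟩ := mem_verts.1 hw
      obtain ⟨e', he', hwe'⟩ := mem_verts.1 hw'
      have hnw := hns e he w hwe
      push Not at hnw
      obtain ⟨he1, he2⟩ := Finset.mem_filter.1 he
      obtain ⟨he'α, he'd⟩ := Finset.mem_sdiff.1 he'
      have he'γ : e' ∈ α \ β := Finset.mem_sdiff.2 ⟨he'α, fun h => hnw.1 (mem_rootedVerts.2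
        (Or.inr (Or.inr (mem_verts.2 ⟨e', h, hwe'⟩))))⟩
      have heq : ι e' = ι' e' := by
        by_contra hne
        exact he'd (Finset.mem_filter.2 ⟨he'γ, hne⟩)
      exact he2 ((hι.2 w hnw.1 hnw.2 e he1 e' he'γ hwe hwe').trans
        (heq.trans (hι'.2 w hnw.1 hnw.2 e he1 e' he'γ hwe hwe').symm))
  ext e
  by_cases he : e ∈ α \ β
  · by_contra hne
    have : e ∈ (α \ β).filter (fun e => ι e ≠ ι' e) := Finset.mem_filter.2 ⟨he, hne⟩
    simp [hδ] at this
  · rw [hΛ ι hι.1 e he, hΛ ι' hι'.1 e he]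

open Classical in
/-- The contribution of one colouring to the expansion of the product of a kernel over edges. -/
lemma abs_mean_mul_prod_colouring_le [DecidableEq I] {u v : Fin n} {α β : Finset (Edge n)}
    (hα : Admissible u v α) {π : K → ℝ} (hπ : ∀ k, 0 ≤ π k) (h1 : ∑ k, π k = 1)
    {φ : I → K → ℝ} {Φ : ℝ} (hΦ : 1 ≤ Φ) (hφ : ∀ i k, |φ i k| ≤ Φ)
    (horth : ∀ i j, ∑ k, π k * (φ i k * φ j k) = if i = j then 1 else 0)
    {G : (Fin n → K) → ℝ} (hG : IsLocalOn G (rootedVerts u v β)) (ι : Edge n → I) :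
    |mean π (fun σ => G σ * ∏ e ∈ α \ β, (φ (ι e) (σ e.1.1) * φ (ι e) (σ e.1.2)))| ≤
      mean π (fun σ => |G σ|) *
        (if Consistent u v α β ι then Φ ^ (branchDarts u v α β).card else 0) := by
  have hprod : ∀ σ : Fin n → K, ∏ e ∈ α \ β, (φ (ι e) (σ e.1.1) * φ (ι e) (σ e.1.2)) =
      ∏ w, ∏ e ∈ (α \ β).filter (Inc w), φ (ι e) (σ w) := by
    intro σ
    simp only [Finset.prod_filter]
    rw [Finset.prod_comm]
    refine Finset.prod_congr rfl fun e _ => ?_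
    rw [← Finset.prod_filter, prod_inc]
  simp only [hprod]
  let P : Fin n → Prop := fun w => w ∉ rootedVerts u v β → deg α w < 3 →
    ∀ e ∈ α \ β, ∀ e' ∈ α \ β, Inc w e → Inc w e' → ι e = ι e'
  let c : Fin n → ℕ := fun w =>
    ((α \ β).filter fun e => Inc w e ∧ (w ∈ rootedVerts u v β ∨ 3 ≤ deg α w)).card
  have hgle : ∀ w k, |∏ e ∈ (α \ β).filter (Inc w), φ (ι e) k| ≤
      Φ ^ ((α \ β).filter (Inc w)).card := by
    intro w k
    rw [Finset.abs_prod, ← Finset.prod_const]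
    exact Finset.prod_le_prod (fun _ _ => abs_nonneg _) fun _ _ => hφ _ _
  have hc : ∀ w, (w ∈ rootedVerts u v β ∨ 3 ≤ deg α w) →
      c w = ((α \ β).filter (Inc w)).card := by
    intro w hw
    simp only [c]
    congr 1
    ext e
    simp [hw]
  have hΦ0 : 0 ≤ Φ := zero_le_one.trans hΦ
  -- A vertex at which the colouring is inconsistent receives the bound 0, which kills the whole
  -- product.
  have hmain := abs_mean_mul_prod_le hπ h1 hG
    (fun w k => ∏ e ∈ (α \ β).filter (Inc w), φ (ι e) k)
    (fun w => if P w then Φ ^ c w else 0)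
    (fun w => by split_ifs <;> positivity) ?_ ?_
  · refine hmain.trans (mul_le_mul_of_nonneg_left ?_ (mean_nonneg hπ fun _ => abs_nonneg _))
    rw [card_branchDarts_eq_sum, ← Finset.prod_pow_eq_pow_sum]
    by_cases hcons : Consistent u v α β ι
    · rw [if_pos hcons]
      exact (Finset.prod_congr rfl fun w _ => if_pos (hcons w)).le
    · rw [if_neg hcons]
      have : ∃ w, ¬ P w := by
        by_contra! hcon
        exact hcons hcon
      obtain ⟨w, hw⟩ := this
      exact (Finset.prod_eq_zero (Finset.mem_univ w) (if_neg hw)).le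
  · intro w hw k
    have hP : P w := fun h => absurd hw h
    rw [if_pos hP, hc w (Or.inl hw)]
    exact hgle w k
  · intro w hw
    by_cases hw3 : 3 ≤ deg α w
    · have hP : P w := fun _ h => absurd hw3 (by omega)
      rw [if_pos hP, hc w (Or.inr hw3)]
      refine (Finset.abs_sum_le_sum_abs _ _).trans ?_
      calc ∑ k, |π k * ∏ e ∈ (α \ β).filter (Inc w), φ (ι e) k|
          ≤ ∑ k, π k * Φ ^ ((α \ β).filter (Inc w)).card :=
            Finset.sum_le_sum fun k _ => by
              rw [abs_mul, abs_of_nonneg (hπ k)]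
              exact mul_le_mul_of_nonneg_left (hgle w k) (hπ k)
        _ = Φ ^ ((α \ β).filter (Inc w)).card := by rw [← Finset.sum_mul, h1, one_mul]
    · have hdeg : ((α \ β).filter (Inc w)).card = deg α w := deg_sdiff hw
      have hone := hα.leaf w (fun h => hw (mem_rootedVerts.2 (Or.inl h)))
        (fun h => hw (mem_rootedVerts.2 (Or.inr (Or.inl h))))
      have hc0 : c w = 0 := by simp [c, hw, hw3]
      rw [hc0, pow_zero]
      -- At degree two the average is an inner product of two eigenfunctions: 1 if the two colours
      -- agree and 0 otherwise.
      obtain h0 | h2 : deg α w = 0 ∨ deg α w = 2 := by omega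
      · rw [h0, Finset.card_eq_zero] at hdeg
        have hP : P w := by
          intro _ _ e he e' he' hwe _
          have : e ∈ (α \ β).filter (Inc w) := Finset.mem_filter.2 ⟨he, hwe⟩
          simp [hdeg] at this
        simp [hP, hdeg, h1]
      · rw [h2, Finset.card_eq_two] at hdeg
        obtain ⟨a, b, hab, hfil⟩ := hdeg
        simp only [hfil, Finset.prod_pair hab, horth]
        by_cases hP : P w
        · rw [if_pos hP]
          split_ifs <;> simp
        · rw [if_neg hP, if_neg, abs_zero]
          intro heq
          apply hP
          have hcase : ∀ e ∈ α \ β, Inc w e → e = a ∨ e = b := by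
            intro e he hwe
            have : e ∈ (α \ β).filter (Inc w) := Finset.mem_filter.2 ⟨he, hwe⟩
            simpa [hfil] using this
          intro _ _ e he e' he' hwe hwe'
          rcases hcase e he hwe with rfl | rfl <;> rcases hcase e' he' hwe' with rfl | rfl <;>
            simp [heq]

/-- The product of a kernel over the edges of `α \ β` costs its spectral radius for each edge, and a
constant only for each half-edge at a branch vertex. -/
lemma abs_mean_mul_prod_kernel_le [Fintype I] [DecidableEq I] [Nonempty I] {u v : Fin n} {α β : Finset (Edge n)}
    (hα : Admissible u v α) {π : K → ℝ} (hπ : ∀ k, 0 ≤ π k) (h1 : ∑ k, π k = 1)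
    {φ : I → K → ℝ} {Φ : ℝ} (hΦ : 1 ≤ Φ) (hφ : ∀ i k, |φ i k| ≤ Φ)
    (horth : ∀ i j, ∑ k, π k * (φ i k * φ j k) = if i = j then 1 else 0)
    {μ : I → ℝ} {r : ℝ} (hμ : ∀ i, |μ i| ≤ r) {U : K → K → ℝ}
    (hU : ∀ k l, U k l = ∑ i, μ i * (φ i k * φ i l))
    {G : (Fin n → K) → ℝ} (hG : IsLocalOn G (rootedVerts u v β)) :
    |mean π (fun σ => G σ * ∏ e ∈ α \ β, U (σ e.1.1) (σ e.1.2))| ≤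
      mean π (fun σ => |G σ|) * r ^ (α \ β).card *
        (Fintype.card I * Φ) ^ (branchDarts u v α β).card := by
  classical
  obtain ⟨i₀⟩ := ‹Nonempty I›
  have hr : 0 ≤ r := (abs_nonneg _).trans (hμ i₀)
  -- Colours off `α \ β` are frozen at `i₀`, so that only the relevant edges are counted.
  set Λ : Finset (Edge n → I) :=
    Fintype.piFinset fun e => if e ∈ α \ β then Finset.univ else {i₀} with hΛ
  have hexp : ∀ σ : Fin n → K, ∏ e ∈ α \ β, U (σ e.1.1) (σ e.1.2) =
      ∑ ι ∈ Λ, (∏ e ∈ α \ β, μ (ι e)) *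
        ∏ e ∈ α \ β, (φ (ι e) (σ e.1.1) * φ (ι e) (σ e.1.2)) := by
    intro σ
    have := Finset.prod_univ_sum (fun e : Edge n => if e ∈ α \ β then Finset.univ else {i₀})
      (fun e i => if e ∈ α \ β then μ i * (φ i (σ e.1.1) * φ i (σ e.1.2)) else 1)
    rw [← hΛ] at this
    simp only [← Finset.prod_mul_distrib]
    rw [Finset.sum_congr rfl fun ι _ => Fintype.prod_ite_mem (α \ β)
      (fun e => μ (ι e) * (φ (ι e) (σ e.1.1) * φ (ι e) (σ e.1.2)))] at this
    rw [← this, ← Fintype.prod_ite_mem]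
    refine Finset.prod_congr rfl fun e _ => ?_
    by_cases he : e ∈ α \ β
    · simp only [he, if_true, hU]
    · simp only [he, if_false, Finset.sum_singleton]
  have hΛmem : ∀ ι ∈ Λ, ∀ e, e ∉ α \ β → ι e = i₀ := by
    intro ι hι e he
    have := Fintype.mem_piFinset.1 hι e
    rwa [if_neg he, Finset.mem_singleton] at this
  have hsum : mean π (fun σ => G σ * ∏ e ∈ α \ β, U (σ e.1.1) (σ e.1.2)) =
      ∑ ι ∈ Λ, (∏ e ∈ α \ β, μ (ι e)) *
        mean π (fun σ => G σ * ∏ e ∈ α \ β, (φ (ι e) (σ e.1.1) * φ (ι e) (σ e.1.2))) := by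
    simp only [← mean_mul_left]
    rw [← mean_sum]
    congr 1
    ext σ
    rw [hexp, Finset.mul_sum]
    exact Finset.sum_congr rfl fun _ _ => by ring
  rw [hsum]
  have hG0 : 0 ≤ mean π (fun σ => |G σ|) := mean_nonneg hπ fun _ => abs_nonneg _
  calc |∑ ι ∈ Λ, (∏ e ∈ α \ β, μ (ι e)) *
        mean π (fun σ => G σ * ∏ e ∈ α \ β, (φ (ι e) (σ e.1.1) * φ (ι e) (σ e.1.2)))|
      ≤ ∑ ι ∈ Λ, r ^ (α \ β).card * (mean π (fun σ => |G σ|) *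
          (if Consistent u v α β ι then Φ ^ (branchDarts u v α β).card else 0)) := by
        refine (Finset.abs_sum_le_sum_abs _ _).trans (Finset.sum_le_sum fun ι _ => ?_)
        rw [abs_mul]
        refine mul_le_mul ?_ (abs_mean_mul_prod_colouring_le hα hπ h1 hΦ hφ horth hG ι)
          (abs_nonneg _) (pow_nonneg hr _)
        rw [Finset.abs_prod, ← Finset.prod_const]
        exact Finset.prod_le_prod (fun _ _ => abs_nonneg _) fun _ _ => hμ _
    _ = mean π (fun σ => |G σ|) * r ^ (α \ β).card *
          ((Λ.filter (Consistent u v α β)).card * Φ ^ (branchDarts u v α β).card) := by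
        rw [← Finset.mul_sum, ← Finset.mul_sum, ← Finset.sum_filter, Finset.sum_const,
          nsmul_eq_mul]
        ring
    _ ≤ _ := by
        rw [mul_pow]
        have := card_consistent_le hα i₀ Λ hΛmem
        have hΦ0 : 0 ≤ Φ := zero_le_one.trans hΦ
        gcongr
        exact_mod_cast this

/-- Along a growth the expectation of the product of a stochastic kernel loses a factor only when
the counter is raised. -/
lemma Grown.pow_le_mean_prod {u v h : Fin n} {β : Finset (Edge n)} {k : ℕ}
    (hg : Grown u v β h k) {π : K → ℝ} (hπ : ∀ k, 0 ≤ π k) (h1 : ∑ k, π k = 1)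
    {W : K → K → ℝ} {m : ℝ} (hm : 0 ≤ m) (hW : ∀ k l, m ≤ W k l)
    (hl : ∀ k, ∑ l, π l * W k l = 1) (hr : ∀ l, ∑ k, π k * W k l = 1) :
    m ^ k ≤ mean π (fun σ => ∏ e ∈ β, W (σ e.1.1) (σ e.1.2)) := by
  have hW0 : ∀ k l, 0 ≤ W k l := fun k l => hm.trans (hW k l)
  induction hg with
  | start => simp [mean_one h1]
  | @new β h b k e hg hh hb hbβ ih =>
    refine ih.trans_eq ?_
    -- The new vertex meets no edge except `e`, and averaging the stochastic kernel over its label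
    -- gives one.
    rw [mean_resample h1 b (fun σ => ∏ e ∈ insert e β, W (σ e.1.1) (σ e.1.2))]
    congr 1
    ext σ
    have hβ : ∀ k, ∏ e ∈ β, W (Function.update σ b k e.1.1) (Function.update σ b k e.1.2) =
        ∏ e ∈ β, W (σ e.1.1) (σ e.1.2) := by
      intro k
      refine Finset.prod_congr rfl fun f hf => ?_
      have hb' : ¬ Inc b f := fun hbf => hbβ (mem_rootedVerts.2 (Or.inr (Or.inr
        (mem_verts.2 ⟨f, hf, hbf⟩))))
      simp only [Inc, not_or] at hb'
      rw [Function.update_of_ne hb'.1, Function.update_of_ne hb'.2]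
    simp only [Finset.prod_insert (not_mem_of_not_mem_verts hb hbβ), hβ, ← mul_assoc]
    rw [← Finset.sum_mul]
    have hne := e.2.ne
    rcases hb with hb | hb
    · subst hb
      simp [Function.update_of_ne hne.symm, hr]
    · subst hb
      simp [Function.update_of_ne hne, hl]
  | @close β h c k e hg he hh ho hc ih =>
    rw [pow_succ]
    refine (mul_le_mul_of_nonneg_right ih hm).trans ?_
    rw [← mean_mul_right]
    refine mean_mono hπ fun σ => ?_
    rw [Finset.prod_insert he, mul_comm]
    exact mul_le_mul_of_nonneg_right (hW _ _) (Finset.prod_nonneg fun _ _ => hW0 _ _)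

end Kernel

/-! ### The triangular system of moment equations. -/

section Coefficients

variable {n : ℕ} {K : Type*}

/-- The product of a kernel over the edges of a graph. -/
noncomputable def edgeProd (A : K → K → ℝ) (α : Finset (Edge n)) (σ : Fin n → K) : ℝ :=
  ∏ e ∈ α, A (σ e.1.1) (σ e.1.2)

lemma isLocalOn_edgeProd (A : K → K → ℝ) (α : Finset (Edge n)) :
    IsLocalOn (edgeProd A α) (verts α) := by
  intro σ τ h
  refine Finset.prod_congr rfl fun e he => ?_
  rw [h _ (fst_mem_verts he), h _ (snd_mem_verts he)]

lemma edgeProd_union {A : K → K → ℝ} {α β : Finset (Edge n)} (h : Disjoint α β)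
    (σ : Fin n → K) : edgeProd A (α ∪ β) σ = edgeProd A α σ * edgeProd A β σ :=
  Finset.prod_union h

variable [Fintype K]

lemma mean_single {π : K → ℝ} (h1 : ∑ k, π k = 1) (w : Fin n) (f : K → ℝ) :
    mean π (fun σ : Fin n → K => f (σ w)) = ∑ k, π k * f k := by
  rw [mean_resample h1 w]
  simp only [Function.update_self]
  have := mean_mul_left (V := Fin n) (π := π) (∑ k, π k * f k) (fun _ => 1)
  rw [mean_one h1] at this
  simpa using this

/-- A centred kernel averages to zero over a leaf. -/
lemma mean_mul_edgeProd_leaf {π : K → ℝ} (h1 : ∑ k, π k = 1) {B : K → K → ℝ}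
    (hl : ∀ k, ∑ l, π l * B k l = 0) (hr : ∀ l, ∑ k, π k * B k l = 0) {γ : Finset (Edge n)}
    {e : Edge n} {a : Fin n} (he : e ∈ γ) (ha : Inc a e) (huniq : ∀ f ∈ γ, Inc a f → f = e)
    {H : (Fin n → K) → ℝ} {S : Finset (Fin n)} (hH : IsLocalOn H S) (haS : a ∉ S) :
    mean π (fun σ => H σ * edgeProd B γ σ) = 0 := by
  rw [mean_resample h1 a]
  have h0 : ∀ σ : Fin n → K, ∑ k, π k * (H (Function.update σ a k) *
      edgeProd B γ (Function.update σ a k)) = 0 := by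
    intro σ
    have hrest : ∀ k, edgeProd B (γ.erase e) (Function.update σ a k) =
        edgeProd B (γ.erase e) σ := by
      intro k
      refine (isLocalOn_edgeProd B _).update (fun hmem => ?_) σ k
      obtain ⟨f, hf, haf⟩ := mem_verts.1 hmem
      exact Finset.ne_of_mem_erase hf (huniq f (Finset.mem_of_mem_erase hf) haf)
    have hsplit : ∀ τ : Fin n → K, edgeProd B γ τ =
        B (τ e.1.1) (τ e.1.2) * edgeProd B (γ.erase e) τ := fun τ =>
      (Finset.mul_prod_erase γ (fun e => B (τ e.1.1) (τ e.1.2)) he).symm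
    simp only [hH.update haS, hsplit, hrest]
    have hne := e.2.ne
    have hrw : ∀ k, π k * (H σ * (B (Function.update σ a k e.1.1) (Function.update σ a k e.1.2) *
        edgeProd B (γ.erase e) σ)) = π k * B (Function.update σ a k e.1.1)
          (Function.update σ a k e.1.2) * (H σ * edgeProd B (γ.erase e) σ) := fun k => by ring
    simp only [hrw]
    rw [← Finset.sum_mul]
    rcases ha with ha | ha
    · subst ha
      simp [Function.update_of_ne hne.symm, hr]
    · subst ha
      simp [Function.update_of_ne hne, hl]
  simp only [h0]
  simp [mean]

/-- The mixed moment of the graphs `β ⊆ α`. -/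
noncomputable def mixedMoment (π : K → ℝ) (A B : K → K → ℝ) (β α : Finset (Edge n)) : ℝ :=
  mean π (fun σ => edgeProd A β σ * edgeProd B (α \ β) σ)

open Classical in
/-- The coefficients that solve the triangular system of the moment equations. -/
noncomputable def coef (u v : Fin n) (π : K → ℝ) (A B : K → K → ℝ) (x : (Fin n → K) → ℝ)
    (α : Finset (Edge n)) : ℝ :=
  if Admissible u v α then
    mean π (fun σ => x σ * edgeProd B α σ) -
      ∑ β ∈ α.ssubsets.attach, coef u v π A B x β.1 / mean π (edgeProd A β.1) *
        mixedMoment π A B β.1 α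
  else 0
termination_by α.card
decreasing_by exact Finset.card_lt_card (Finset.mem_ssubsets.1 β.2)

lemma coef_of_not_admissible {u v : Fin n} {π : K → ℝ} {A B : K → K → ℝ}
    {x : (Fin n → K) → ℝ} {α : Finset (Edge n)} (h : ¬ Admissible u v α) :
    coef u v π A B x α = 0 := by
  rw [coef, if_neg h]

lemma coef_of_admissible {u v : Fin n} {π : K → ℝ} {A B : K → K → ℝ}
    {x : (Fin n → K) → ℝ} {α : Finset (Edge n)} (h : Admissible u v α) :
    coef u v π A B x α = mean π (fun σ => x σ * edgeProd B α σ) -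
      ∑ β ∈ α.ssubsets, coef u v π A B x β / mean π (edgeProd A β) * mixedMoment π A B β α := by
  rw [coef, if_pos h, Finset.sum_attach α.ssubsets fun β =>
    coef u v π A B x β / mean π (edgeProd A β) * mixedMoment π A B β α]

/-- The moment equations hold for all graphs. -/
lemma sum_coef_mul_mixedMoment {u v : Fin n} (huv : u ≠ v) {π : K → ℝ} (h1 : ∑ k, π k = 1)
    {A B : K → K → ℝ} (hA : ∀ β : Finset (Edge n), mean π (edgeProd A β) ≠ 0)
    (hl : ∀ k, ∑ l, π l * B k l = 0) (hr : ∀ l, ∑ k, π k * B k l = 0) {f g : K → ℝ}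
    (hf : ∑ k, π k * f k = 0) (hg : ∑ k, π k * g k = 0) {x : (Fin n → K) → ℝ}
    (hx : ∀ σ, x σ = f (σ u) * g (σ v)) (α : Finset (Edge n)) :
    ∑ β ∈ α.powerset, coef u v π A B x β / mean π (edgeProd A β) * mixedMoment π A B β α =
      mean π (fun σ => x σ * edgeProd B α σ) := by
  induction α using Finset.strongInduction with
  | H α ih =>
  by_cases hadm : Admissible u v α
  · rw [← Finset.add_sum_erase _ _ (Finset.mem_powerset_self α), coef_of_admissible hadm]
    have : mixedMoment π A B α α = mean π (edgeProd A α) := by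
      simp only [mixedMoment, Finset.sdiff_self]
      simp [edgeProd]
      rfl
    rw [this, div_mul_cancel₀ _ (hA α), Finset.ssubsets, sub_add_cancel]
  have hlocf : ∀ w, ∀ f : K → ℝ, IsLocalOn (fun σ : Fin n → K => f (σ w)) {w} :=
    fun w f σ τ h => by simp only [h w (Finset.mem_singleton_self w)]
  have hxloc : IsLocalOn x {u, v} := by
    intro σ τ h
    rw [hx, hx, h u (by simp), h v (by simp)]
  -- If a root is not covered, its centred factor in `x` is independent of the rest, so the right
  -- side vanishes; no subgraph covers it either, so all coefficients vanish.
  by_cases hu : u ∈ verts α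
  swap
  · have hc : mean π (fun σ => x σ * edgeProd B α σ) = 0 := by
      have : (fun σ => x σ * edgeProd B α σ) =
          fun σ => f (σ u) * (g (σ v) * edgeProd B α σ) := by
        ext σ
        rw [hx]
        ring
      rw [this, mean_mul_of_disjoint h1 (A := {u}) (B := insert v (verts α)) (hlocf u f)
        (((hlocf v g).mono (by simp)).mul ((isLocalOn_edgeProd B α).mono (by simp)))
        (by simp [huv, hu]), mean_single h1, hf, zero_mul]
    rw [hc]
    refine Finset.sum_eq_zero fun β hβ => ?_
    rw [coef_of_not_admissible, zero_div, zero_mul]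
    exact fun h => hu (verts_mono (Finset.mem_powerset.1 hβ) h.left)
  by_cases hv : v ∈ verts α
  swap
  · have hc : mean π (fun σ => x σ * edgeProd B α σ) = 0 := by
      have : (fun σ => x σ * edgeProd B α σ) =
          fun σ => g (σ v) * (f (σ u) * edgeProd B α σ) := by
        ext σ
        rw [hx]
        ring
      rw [this, mean_mul_of_disjoint h1 (A := {v}) (B := insert u (verts α)) (hlocf v g)
        (((hlocf u f).mono (by simp)).mul ((isLocalOn_edgeProd B α).mono (by simp)))
        (by simp [huv.symm, hv]), mean_single h1, hg, zero_mul]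
    rw [hc]
    refine Finset.sum_eq_zero fun β hβ => ?_
    rw [coef_of_not_admissible, zero_div, zero_mul]
    exact fun h => hv (verts_mono (Finset.mem_powerset.1 hβ) h.right)
  -- A leaf edge in `β` makes `β` inadmissible; a leaf edge outside `β` contributes a centred kernel
  -- that averages to zero.
  by_cases hleaf : ∀ w, w ≠ u → w ≠ v → deg α w ≠ 1
  swap
  · push Not at hleaf
    obtain ⟨a, hau, hav, hdeg⟩ := hleaf
    obtain ⟨e, he⟩ := Finset.card_eq_one.1 hdeg
    have hmem : ∀ f, f ∈ α ∧ Inc a f ↔ f = e := fun f => by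
      rw [← Finset.mem_filter, he, Finset.mem_singleton]
    obtain ⟨heα, hae⟩ := (hmem e).2 rfl
    rw [mean_mul_edgeProd_leaf h1 hl hr heα hae (fun f hf haf => (hmem f).1 ⟨hf, haf⟩) hxloc
      (by simp [hau, hav])]
    refine Finset.sum_eq_zero fun β hβ => ?_
    rw [Finset.mem_powerset] at hβ
    by_cases heβ : e ∈ β
    · rw [coef_of_not_admissible, zero_div, zero_mul]
      refine fun h => h.leaf a hau hav (Finset.card_eq_one.2 ⟨e, ?_⟩)
      ext f
      rw [Finset.mem_filter, Finset.mem_singleton]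
      exact ⟨fun hf => (hmem f).1 ⟨hβ hf.1, hf.2⟩, fun hf => hf ▸ ⟨heβ, hae⟩⟩
    · rw [mixedMoment, mean_mul_edgeProd_leaf h1 hl hr (Finset.mem_sdiff.2 ⟨heα, heβ⟩) hae
        (fun f hf haf => (hmem f).1 ⟨(Finset.mem_sdiff.1 hf).1, haf⟩) (isLocalOn_edgeProd A β),
        mul_zero]
      intro ha
      obtain ⟨f, hf, haf⟩ := mem_verts.1 ha
      exact heβ ((hmem f).1 ⟨hβ hf, haf⟩ ▸ hf)
  -- In the remaining case a part `γ` is separated from the roots. Its moment factors out of both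
  -- sides, subgraphs meeting `γ` are inadmissible, and the equation for `α \ γ` remains.
  have hconn : ∃ γ ⊆ α, u ∉ verts γ ∧ v ∉ verts γ ∧ (∀ w ∈ verts γ, w ∉ verts (α \ γ)) ∧
      γ ≠ ∅ := by
    by_contra! hcon
    exact hadm ⟨hu, hv, hleaf, fun γ h1 h2 h3 h4 => hcon γ h1 h2 h3 h4⟩
  obtain ⟨γ, hγα, huγ, hvγ, hsep, hne⟩ := hconn
  have hss : α \ γ ⊂ α := Finset.sdiff_ssubset hγα (Finset.nonempty_iff_ne_empty.2 hne)
  have hdisj : Disjoint (insert u (insert v (verts (α \ γ)))) (verts γ) := by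
    rw [Finset.disjoint_left]
    intro w hw hwγ
    simp only [Finset.mem_insert] at hw
    rcases hw with rfl | rfl | hw
    · exact huγ hwγ
    · exact hvγ hwγ
    · exact hsep w hwγ hw
  have hdisj' : Disjoint (verts (α \ γ)) (verts γ) :=
    hdisj.mono_left ((Finset.subset_insert _ _).trans (Finset.subset_insert _ _))
  have hc : mean π (fun σ => x σ * edgeProd B α σ) =
      mean π (fun σ => x σ * edgeProd B (α \ γ) σ) * mean π (edgeProd B γ) := by
    rw [← mean_mul_of_disjoint h1 ((hxloc.mono _).mul ((isLocalOn_edgeProd B (α \ γ)).mono _))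
      (isLocalOn_edgeProd B γ) hdisj]
    · congr 1
      ext σ
      rw [mul_assoc, ← edgeProd_union Finset.sdiff_disjoint, Finset.sdiff_union_of_subset hγα]
    · intro w
      simp only [Finset.mem_insert, Finset.mem_singleton]
      tauto
    · exact (Finset.subset_insert _ _).trans (Finset.subset_insert _ _)
  rw [hc, ← ih _ hss, Finset.sum_mul,
    ← Finset.sum_subset (Finset.powerset_mono.2 (Finset.sdiff_subset : α \ γ ⊆ α))]
  · refine Finset.sum_congr rfl fun β hβ => ?_
    rw [Finset.mem_powerset] at hβ
    rw [mul_assoc]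
    congr 1
    rw [mixedMoment, mixedMoment, ← mean_mul_of_disjoint h1
      (((isLocalOn_edgeProd A β).mono (verts_mono hβ)).mul
        ((isLocalOn_edgeProd B _).mono (verts_mono Finset.sdiff_subset)))
      (isLocalOn_edgeProd B γ) hdisj']
    congr 1
    ext σ
    have hd : Disjoint ((α \ γ) \ β) γ :=
      Finset.sdiff_disjoint.mono_left Finset.sdiff_subset
    rw [mul_assoc, ← edgeProd_union hd]
    congr 2
    ext e
    simp only [Finset.mem_sdiff, Finset.mem_union]
    have := @hγα e
    have := @hβ e
    simp only [Finset.mem_sdiff] at this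
    tauto
  · intro β hβ hβ'
    rw [Finset.mem_powerset] at hβ hβ'
    rw [coef_of_not_admissible, zero_div, zero_mul]
    intro h
    have h0 := h.conn (β ∩ γ) Finset.inter_subset_left
      (fun h' => huγ (verts_mono Finset.inter_subset_right h'))
      (fun h' => hvγ (verts_mono Finset.inter_subset_right h')) fun w hw hw' =>
        hsep w (verts_mono Finset.inter_subset_right hw) (verts_mono (fun e he => by
          simp only [Finset.mem_sdiff, Finset.mem_inter] at he ⊢
          exact ⟨hβ he.1, fun hγ => he.2 ⟨he.1, hγ⟩⟩) hw')
    refine hβ' fun e he => Finset.mem_sdiff.2 ⟨hβ he, fun hγ => ?_⟩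
    have : e ∈ β ∩ γ := Finset.mem_inter.2 ⟨he, hγ⟩
    simp [h0] at this

end Coefficients

/-! ### Size of the coefficients. -/

section Bound

variable {n : ℕ}

/-- The half-edges of a graph. -/
def darts (α : Finset (Edge n)) : Finset (Fin n × Edge n) :=
  Finset.univ.filter fun p => p.2 ∈ α ∧ Inc p.1 p.2

lemma card_darts (α : Finset (Edge n)) : (darts α).card = 2 * α.card := by
  rw [Finset.card_eq_sum_card_fiberwise (f := Prod.snd) (t := α)
    (fun p hp => (Finset.mem_filter.1 hp).2.1), Finset.sum_congr rfl (g := fun _ => 2)]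
  · simp [mul_comm]
  · intro e he
    rw [← card_inc e]
    refine Finset.card_bij (fun p _ => p.1) ?_ ?_ ?_
    · rintro ⟨w, f⟩ h
      simp only [darts, Finset.mem_filter, Finset.mem_univ, true_and] at h ⊢
      exact h.2 ▸ h.1.2
    · rintro ⟨w, f⟩ h ⟨w', f'⟩ h' hww
      simp only [Finset.mem_filter] at h h' hww
      rw [hww, h.2.trans h'.2.symm]
    · intro w hw
      refine ⟨(w, e), ?_, rfl⟩
      simp only [darts, Finset.mem_filter, Finset.mem_univ, true_and] at hw ⊢
      exact ⟨⟨he, hw⟩, trivial⟩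

lemma branchDarts_subset_darts (u v : Fin n) (α β : Finset (Edge n)) :
    branchDarts u v α β ⊆ darts α := by
  intro p hp
  simp only [branchDarts, darts, Finset.mem_filter, Finset.mem_univ, true_and,
    Finset.mem_sdiff] at hp ⊢
  exact ⟨hp.1.1, hp.2.1⟩

/-- Weighted count of the subgraphs of an admissible graph. -/
lemma sum_pow_card_branchDarts_le {u v : Fin n} {α : Finset (Edge n)} (hα : Admissible u v α)
    {D : ℕ} (hD : α.card ≤ D) (hD1 : 1 ≤ D) :
    ∑ β ∈ α.ssubsets, ((1 : ℝ) / (2 * D)) ^ (branchDarts u v α β).card ≤ 3 := by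
  have hD0 : (0 : ℝ) < 2 * D := by positivity
  -- Distinct subgraphs have distinct sets of branch half-edges. The sum over all sets of half-edges
  -- is a binomial expansion, and the weight `1 / (2 D)` keeps it below `e`.
  calc ∑ β ∈ α.ssubsets, ((1 : ℝ) / (2 * D)) ^ (branchDarts u v α β).card
      = ∑ S ∈ α.ssubsets.image (branchDarts u v α), ((1 : ℝ) / (2 * D)) ^ S.card := by
        rw [Finset.sum_image]
        exact (branchDarts_injOn hα).mono fun β hβ => (Finset.mem_ssubsets.1 hβ).1
    _ ≤ ∑ S ∈ (darts α).powerset, ((1 : ℝ) / (2 * D)) ^ S.card := by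
        refine Finset.sum_le_sum_of_subset_of_nonneg ?_ fun _ _ _ => by positivity
        intro S hS
        obtain ⟨β, -, rfl⟩ := Finset.mem_image.1 hS
        exact Finset.mem_powerset.2 (branchDarts_subset_darts u v α β)
    _ = (1 / (2 * D) + 1) ^ (darts α).card := by
        rw [← Finset.sum_pow_mul_eq_add_pow]
        simp
    _ ≤ (1 / (2 * D) + 1) ^ (2 * D) := by
        rw [card_darts]
        exact pow_le_pow_right₀ (by linarith [one_div_pos.2 hD0]) (by omega)
    _ ≤ (Real.exp (1 / (2 * D))) ^ (2 * D) :=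
        pow_le_pow_left₀ (by positivity) (Real.add_one_le_exp _) _
    _ = Real.exp 1 := by
        rw [← Real.exp_nat_mul]
        congr 1
        push_cast
        field_simp
    _ ≤ 3 := by linarith [Real.exp_one_lt_d9]

/-- The coefficients are as small as the spectral radius allows. -/
lemma abs_coef_le {K I : Type*} [Fintype K] [Fintype I] [DecidableEq I] [Nonempty I]
    {u v : Fin n} {π : K → ℝ} (hπ : ∀ k, 0 ≤ π k) (h1 : ∑ k, π k = 1)
    {φ : I → K → ℝ} {Φ : ℝ} (hΦ : 1 ≤ Φ) (hφ : ∀ i k, |φ i k| ≤ Φ)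
    (horth : ∀ i j, ∑ k, π k * (φ i k * φ j k) = if i = j then 1 else 0)
    {μ : I → ℝ} {r : ℝ} (hμ : ∀ i, |μ i| ≤ r) {A B : K → K → ℝ}
    (hB : ∀ k l, B k l = ∑ i, μ i * (φ i k * φ i l)) (hA0 : ∀ k l, 0 ≤ A k l)
    (hA : ∀ β : Finset (Edge n), mean π (edgeProd A β) ≠ 0) {x : (Fin n → K) → ℝ}
    (hx : ∀ σ, |x σ| ≤ 1) (hxloc : IsLocalOn x {u, v}) {D : ℕ} (hD1 : 1 ≤ D)
    {α : Finset (Edge n)} (hα : Admissible u v α) (hD : α.card ≤ D) :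
    |coef u v π A B x α| ≤ r ^ α.card * ((Fintype.card I * Φ) ^ (6 * excess u v α) *
      (4 * (2 * D) ^ 6) ^ (excess u v α - 1)) := by
  obtain ⟨i₀⟩ := ‹Nonempty I›
  have hr : 0 ≤ r := (abs_nonneg _).trans (hμ i₀)
  set κ : ℝ := Fintype.card I * Φ with hκ
  have hκ1 : 1 ≤ κ := by
    have : (1 : ℝ) ≤ Fintype.card I := by
      exact_mod_cast Fintype.card_pos_iff.2 ⟨i₀⟩
    exact one_le_mul_of_one_le_of_one_le this hΦ
  have hκ0 : 0 ≤ κ := zero_le_one.trans hκ1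
  have hR : (1 : ℝ) ≤ 2 * D := by
    have : (1 : ℝ) ≤ D := by exact_mod_cast hD1
    linarith
  set R : ℝ := 2 * D with hRdef
  have hR0 : 0 < R := by linarith
  induction α using Finset.strongInduction with
  | H α ih =>
  have hk := excess_pos hα
  have hedge0 : ∀ (β : Finset (Edge n)) (σ : Fin n → K), 0 ≤ edgeProd A β σ := fun β σ =>
    Finset.prod_nonneg fun _ _ => hA0 _ _
  have hc : |mean π (fun σ => x σ * edgeProd B α σ)| ≤ r ^ α.card * κ ^ (6 * excess u v α) := by
    have h := abs_mean_mul_prod_kernel_le (β := ∅) hα hπ h1 hΦ hφ horth hμ hB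
      (hxloc.mono (by intro w; simp [rootedVerts]; tauto))
    rw [Finset.sdiff_empty, ← hκ] at h
    have hx1 : mean π (fun σ => |x σ|) ≤ 1 := (mean_mono hπ hx).trans_eq (mean_one h1)
    refine h.trans ?_
    have hx0 : 0 ≤ mean π (fun σ => |x σ|) := mean_nonneg hπ fun _ => abs_nonneg _
    calc _ ≤ 1 * r ^ α.card * κ ^ (6 * excess u v α) := by
          gcongr
          exact card_branchDarts_empty_le hα
      _ = _ := by ring
  -- The excess drops from `α` to `β` by at least one and by at least a sixth of the number `b` of
  -- branch half-edges. So the induction bound for `β` has room for a factor `4 R ^ b`, which yields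
  -- the summable weight.
  have hterm : ∀ β ∈ α.ssubsets,
      |coef u v π A B x β / mean π (edgeProd A β) * mixedMoment π A B β α| ≤
        r ^ α.card * (κ ^ (6 * excess u v α) * (4 * R ^ 6) ^ (excess u v α - 1)) *
          (1 / 4 * (1 / R) ^ (branchDarts u v α β).card) := by
    intro β hβ
    have hβα := Finset.mem_ssubsets.1 hβ
    by_cases hadm : Admissible u v β
    swap
    · rw [coef_of_not_admissible hadm, zero_div, zero_mul, abs_zero]
      positivity
    have hN : 0 < mean π (edgeProd A β) :=
      lt_of_le_of_ne (mean_nonneg hπ (hedge0 β)) (hA β).symm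
    have hM := abs_mean_mul_prod_kernel_le hα hπ h1 hΦ hφ horth hμ hB
      ((isLocalOn_edgeProd A β).mono (show verts β ⊆ rootedVerts u v β from
        (Finset.subset_insert _ _).trans (Finset.subset_insert _ _)))
    simp only [abs_of_nonneg (hedge0 β _)] at hM
    rw [← hκ] at hM
    have hw := ih β hβα hadm ((Finset.card_le_card hβα.1).trans hD)
    have hlt := excess_lt hα hadm hβα
    have hbd := card_branchDarts_le_excess hα hadm hβα.1
    have hkβ := excess_pos hadm
    set b := (branchDarts u v α β).card
    rw [abs_mul, abs_div, abs_of_pos hN]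
    calc |coef u v π A B x β| / mean π (edgeProd A β) * |mixedMoment π A B β α|
        ≤ (r ^ β.card * (κ ^ (6 * excess u v β) * (4 * R ^ 6) ^ (excess u v β - 1))) /
            mean π (edgeProd A β) *
            (mean π (edgeProd A β) * r ^ (α \ β).card * κ ^ b) := by
          gcongr
          exact hM
      _ = (r ^ β.card * r ^ (α \ β).card) * (κ ^ (6 * excess u v β) * κ ^ b) *
            (4 * R ^ 6) ^ (excess u v β - 1) := by
          field_simp
      _ = r ^ α.card * κ ^ (6 * excess u v β + b) * (4 * R ^ 6) ^ (excess u v β - 1) := by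
          rw [← pow_add, ← pow_add, add_comm β.card, Finset.card_sdiff_add_card_eq_card hβα.1]
      _ ≤ r ^ α.card * κ ^ (6 * excess u v α) *
            ((4 * R ^ 6) ^ (excess u v α - 1) * (1 / 4 * (1 / R) ^ b)) := by
          refine mul_le_mul (mul_le_mul_of_nonneg_left ?_ (by positivity)) ?_ (by positivity)
            (by positivity)
          · exact pow_le_pow_right₀ hκ1 (by omega)
          · have h4 : (4 : ℝ) * R ^ b ≤ (4 * R ^ 6) ^ (excess u v α - excess u v β) := by
              rw [mul_pow (4 : ℝ), ← pow_mul]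
              exact mul_le_mul (le_self_pow₀ (by norm_num) (by omega))
                (pow_le_pow_right₀ hR (by omega)) (by positivity) (by positivity)
            have h5 : (4 * R ^ 6) ^ (excess u v α - 1) = (4 * R ^ 6) ^ (excess u v β - 1) *
                (4 * R ^ 6) ^ (excess u v α - excess u v β) := by
              rw [← pow_add]
              congr 1
              omega
            rw [h5, mul_assoc]
            refine le_mul_of_one_le_right (by positivity) ?_
            calc (1 : ℝ) = 4 * R ^ b * (1 / 4 * (1 / R) ^ b) := by
                  rw [one_div_pow]
                  field_simp
              _ ≤ _ := by gcongr
      _ = _ := by ring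
  rw [coef_of_admissible hα]
  -- At excess one there are no proper admissible subgraphs, so no factor depending on `D` arises.
  -- Otherwise `Bd ≥ 4`, and the direct moment and the sum over subgraphs take shares `1 / 4` and `3
  -- / 4` of the bound.
  by_cases hk1 : excess u v α = 1
  · have h0 : ∑ β ∈ α.ssubsets,
        coef u v π A B x β / mean π (edgeProd A β) * mixedMoment π A B β α = 0 := by
      refine Finset.sum_eq_zero fun β hβ => ?_
      rw [coef_of_not_admissible, zero_div, zero_mul]
      intro hadm
      have := excess_lt hα hadm (Finset.mem_ssubsets.1 hβ)
      have := excess_pos hadm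
      omega
    rw [h0, sub_zero]
    refine hc.trans_eq ?_
    rw [hk1]
    ring
  · set Bd : ℝ := (4 * R ^ 6) ^ (excess u v α - 1) with hBd
    have hBd4 : 4 ≤ Bd := by
      have h4 : (4 : ℝ) ≤ 4 * R ^ 6 := by
        have := one_le_pow₀ hR (n := 6)
        linarith
      exact h4.trans (le_self_pow₀ (by linarith) (by omega))
    have hsum : |∑ β ∈ α.ssubsets,
        coef u v π A B x β / mean π (edgeProd A β) * mixedMoment π A B β α| ≤
          r ^ α.card * (κ ^ (6 * excess u v α) * Bd) * (1 / 4 * 3) := by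
      refine (Finset.abs_sum_le_sum_abs _ _).trans ((Finset.sum_le_sum hterm).trans ?_)
      rw [← Finset.mul_sum, ← Finset.mul_sum]
      have := sum_pow_card_branchDarts_le hα hD hD1
      gcongr
    have hcoef : 0 ≤ r ^ α.card * κ ^ (6 * excess u v α) := by positivity
    calc _ ≤ _ := abs_sub _ _
      _ ≤ r ^ α.card * κ ^ (6 * excess u v α) +
          r ^ α.card * (κ ^ (6 * excess u v α) * Bd) * (1 / 4 * 3) := add_le_add hc hsum
      _ ≤ _ := by nlinarith

end Bound

/-! ### Spectral decomposition of the centred kernel. -/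

section Spectral

/-- If two entries of a multiset are at least `b`, so is the second entry of its decreasing list. -/
lemma le_getD_one_sort {m s : Multiset ℝ} {a b : ℝ} (hm : m = a ::ₘ b ::ₘ s) (hba : b ≤ a) :
    b ≤ (m.sort (fun a b : ℝ => a ≥ b)).getD 1 0 := by
  have hperm : ((m.sort (fun a b : ℝ => a ≥ b) : List ℝ) : Multiset ℝ) = a ::ₘ b ::ₘ s := by
    rw [Multiset.sort_eq, hm]
  have hsorted := Multiset.pairwise_sort m (fun a b : ℝ => a ≥ b)
  generalize m.sort (fun a b : ℝ => a ≥ b) = l at hperm hsorted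
  have hlen := congrArg Multiset.card hperm
  rcases l with _ | ⟨x, _ | ⟨y, t⟩⟩
  · simp at hlen
  · simp at hlen
  -- If the second entry `y` were below `b`, both `a` and `b` would exceed `y`, but in the sorted
  -- list at most the first entry does.
  · by_contra! hlt
    simp only [List.getD_cons_succ, List.getD_cons_zero] at hlt
    have hcount := congrArg (Multiset.countP (fun z => y < z)) hperm
    have ht : List.countP (fun z => decide (y < z)) t = 0 := by
      rw [List.countP_eq_zero]
      intro z hz
      have := (List.pairwise_cons.1 (List.pairwise_cons.1 hsorted).2).1 z hz
      simpa using this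
    rw [Multiset.countP_cons_of_pos _ (hlt.trans_le hba), Multiset.countP_cons_of_pos _ hlt,
      Multiset.coe_countP, List.countP_cons, List.countP_cons, ht] at hcount
    simp only [lt_self_iff_false, decide_false, Bool.false_eq_true, if_false] at hcount
    split_ifs at hcount <;> omega

variable {q : ℕ} {π : Fin q → ℝ} {W : Matrix (Fin q) (Fin q) ℝ}

/-- The spectral decomposition of a symmetric kernel with respect to a probability vector. -/
lemma exists_eigenfunctions (hπ : ∀ k, 0 < π k) (hW : ∀ k l, W k l = W l k) :
    ∃ (ρ : Fin q → ℝ) (φ : Fin q → Fin q → ℝ),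
      (∀ i j, ∑ k, π k * (φ i k * φ j k) = if i = j then 1 else 0) ∧
      (∀ i k, ∑ l, W k l * π l * φ i l = ρ i * φ i k) ∧
      (∀ k l, W k l = ∑ i, ρ i * (φ i k * φ i l)) ∧
      (∀ f : Fin q → ℝ, ∑ k, π k * f k ^ 2 = ∑ i, (∑ k, π k * (f k * φ i k)) ^ 2) ∧
      (Matrix.diagonal π * W).charpoly = ∏ i, (Polynomial.X - Polynomial.C (ρ i)) := by
  set s : Fin q → ℝ := fun k => √(π k) with hs
  have hs0 : ∀ k, s k ≠ 0 := fun k => (Real.sqrt_pos.2 (hπ k)).ne'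
  have hss : ∀ k, s k * s k = π k := fun k => Real.mul_self_sqrt (hπ k).le
  -- Conjugation by `√π` makes the operator symmetric; dividing its orthonormal eigenvectors by `√π`
  -- makes them orthonormal in `L²(π)`.
  set S : Matrix (Fin q) (Fin q) ℝ := Matrix.of fun k l => s k * W k l * s l with hSdef
  have hS : S.IsHermitian := by
    ext k l
    simp only [Matrix.conjTranspose_apply, hSdef, Matrix.of_apply, star_trivial, hW l k]
    ring
  set b := hS.eigenvectorBasis with hb
  have hinner : ∀ x y : EuclideanSpace ℝ (Fin q), inner ℝ x y = ∑ k, x k * y k := fun x y => by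
    simp [PiLp.inner_apply, mul_comm]
  have hbb : ∀ i j, ∑ k, b i k * b j k = if i = j then 1 else 0 := fun i j => by
    rw [← hinner]
    exact orthonormal_iff_ite.1 b.orthonormal i j
  have hcomp : ∀ x y : Fin q → ℝ, ∑ i, (∑ k, x k * b i k) * (∑ k, b i k * y k) =
      ∑ k, x k * y k := fun x y => by
    have := b.sum_inner_mul_inner (WithLp.toLp 2 x) (WithLp.toLp 2 y)
    simpa only [hinner] using this
  have heig : ∀ i k, ∑ l, S k l * b i l = hS.eigenvalues i * b i k := fun i k => by
    have := congrFun (hS.mulVec_eigenvectorBasis i) k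
    simpa [Matrix.mulVec, dotProduct] using this
  refine ⟨hS.eigenvalues, fun i k => b i k / s k, fun i j => ?_, fun i k => ?_, fun k l => ?_,
    fun f => ?_, ?_⟩
  · rw [← hbb i j]
    refine Finset.sum_congr rfl fun k _ => ?_
    rw [← hss]
    have := hs0 k
    field_simp
  · have h := heig i k
    have hk := hs0 k
    have : ∑ l, W k l * π l * (b i l / s l) = (∑ l, S k l * b i l) / s k := by
      rw [Finset.sum_div]
      refine Finset.sum_congr rfl fun l _ => ?_
      have := hs0 l
      simp only [hSdef, Matrix.of_apply]
      rw [← hss]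
      field_simp
    rw [this, h]
    ring
  · have h1 := hcomp (fun m => S k m) (Pi.single l 1)
    simp only [heig] at h1
    simp only [Pi.single_apply, mul_ite, mul_one, mul_zero, Finset.sum_ite_eq',
      Finset.mem_univ, if_true] at h1
    have hk := hs0 k
    have hl := hs0 l
    have h2 : W k l = S k l / (s k * s l) := by
      simp only [hSdef, Matrix.of_apply]
      field_simp
    rw [h2, ← h1, Finset.sum_div]
    refine Finset.sum_congr rfl fun i _ => ?_
    field_simp
  · have h1 := hcomp (fun k => s k * f k) (fun k => s k * f k)
    have h2 : ∀ i, ∑ k, s k * f k * b i k = ∑ k, π k * (f k * (b i k / s k)) := fun i => by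
      refine Finset.sum_congr rfl fun k _ => ?_
      have := hs0 k
      rw [← hss]
      field_simp
    have h3 : ∀ i, ∑ k, b i k * (s k * f k) = ∑ k, s k * f k * b i k := fun i =>
      Finset.sum_congr rfl fun k _ => mul_comm _ _
    simp only [h3, h2] at h1
    simp only [sq]
    rw [h1]
    refine Finset.sum_congr rfl fun k _ => ?_
    rw [← hss]
    ring
  · have h1 : Matrix.diagonal π * W =
        Matrix.diagonal s * (S * Matrix.diagonal fun k => (s k)⁻¹) := by
      ext k l
      have hl := hs0 l
      simp only [Matrix.diagonal_mul, Matrix.mul_diagonal, hSdef, Matrix.of_apply]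
      rw [← hss]
      field_simp
    have h2 : (S * Matrix.diagonal fun k => (s k)⁻¹) * Matrix.diagonal s = S := by
      ext k l
      have hl := hs0 l
      simp only [Matrix.mul_diagonal]
      field_simp
    rw [h1, Matrix.charpoly_mul_comm, h2, hS.charpoly_eq]
    rfl

/-- The spectral decomposition of a stochastic kernel minus its trivial part: the eigenvalues are
bounded by the second eigenvalue in modulus. -/
lemma exists_centred_eigenfunctions (hπ : ∀ k, 0 < π k) (h1 : ∑ k, π k = 1)
    (hW : ∀ k l, W k l = W l k) (hWpos : ∀ k l, 0 < W k l) (hst : ∀ k, ∑ l, W k l * π l = 1) :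
    ∃ (μ : Fin q → ℝ) (φ : Fin q → Fin q → ℝ),
      (∀ i j, ∑ k, π k * (φ i k * φ j k) = if i = j then 1 else 0) ∧
      (∀ k l, W k l - 1 = ∑ i, μ i * (φ i k * φ i l)) ∧
      (∀ i, |μ i| ≤ secondEigenvalueAbs (Matrix.diagonal π * W)) := by
  obtain ⟨ρ, φ, horth, heig, hexp, hpars, hchar⟩ := exists_eigenfunctions hπ hW
  have hne : (Finset.univ : Finset (Fin q)).Nonempty := by
    rw [Finset.nonempty_iff_ne_empty]
    intro h
    simp [h] at h1
  -- Evaluate the eigenvalue equation where `|φ i|` is largest.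
  have hρ1 : ∀ i, |ρ i| ≤ 1 := by
    intro i
    obtain ⟨k, -, hk⟩ := Finset.exists_max_image Finset.univ (fun k => |φ i k|) hne
    have hpos : 0 < |φ i k| := by
      by_contra! hle
      have h0 : ∀ l, φ i l = 0 := fun l =>
        abs_nonpos_iff.1 ((hk l (Finset.mem_univ l)).trans hle)
      have := horth i i
      simp [h0] at this
    have h2 : |ρ i| * |φ i k| ≤ 1 * |φ i k| := by
      rw [← abs_mul, ← heig, ← hst k, Finset.sum_mul]
      refine (Finset.abs_sum_le_sum_abs _ _).trans (Finset.sum_le_sum fun l _ => ?_)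
      have := mul_pos (hWpos k l) (hπ l)
      rw [abs_mul, abs_of_pos this]
      exact mul_le_mul_of_nonneg_left (hk l (Finset.mem_univ l)) this.le
    exact le_of_mul_le_mul_right h2 hpos
  -- By Parseval the constant function 1 is not orthogonal to every eigenfunction; such an
  -- eigenfunction has eigenvalue one by symmetry.
  have hex : ∃ i, ∑ k, π k * φ i k ≠ 0 := by
    by_contra! hcon
    have := hpars (fun _ => 1)
    simp [hcon, h1] at this
  obtain ⟨i₀, hi₀⟩ := hex
  have hρ0 : ρ i₀ = 1 := by
    have h2 : ρ i₀ * ∑ k, π k * φ i₀ k = 1 * ∑ k, π k * φ i₀ k := by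
      calc ρ i₀ * ∑ k, π k * φ i₀ k = ∑ k, π k * (ρ i₀ * φ i₀ k) := by
            rw [Finset.mul_sum]
            exact Finset.sum_congr rfl fun _ _ => by ring
        _ = ∑ l, (∑ k, W l k * π k) * (π l * φ i₀ l) := by
            simp only [← heig, Finset.mul_sum, Finset.sum_mul]
            rw [Finset.sum_comm]
            refine Finset.sum_congr rfl fun l _ => Finset.sum_congr rfl fun k _ => ?_
            rw [hW k l]
            ring
        _ = 1 * ∑ k, π k * φ i₀ k := by simp only [hst, one_mul]
    exact mul_right_cancel₀ hi₀ h2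
  -- Maximum principle: at its maximum `φ i₀` equals a strictly positive weighted average of its
  -- values, so it is constant. Subtracting 1 from `W` therefore removes exactly this eigenvalue.
  have hconst : ∀ k l, φ i₀ k * φ i₀ l = 1 := by
    obtain ⟨k, -, hk⟩ := Finset.exists_max_image Finset.univ (φ i₀) hne
    have hsum : ∑ l, W k l * π l * (φ i₀ k - φ i₀ l) = 0 := by
      simp only [mul_sub, Finset.sum_sub_distrib]
      rw [heig, hρ0, ← Finset.sum_mul, hst]
      ring
    have hall : ∀ l, φ i₀ l = φ i₀ k := by
      intro l
      have h3 := (Finset.sum_eq_zero_iff_of_nonneg fun l _ => mul_nonneg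
        (mul_pos (hWpos k l) (hπ l)).le (sub_nonneg.2 (hk l (Finset.mem_univ l)))).1 hsum l
        (Finset.mem_univ l)
      have := (mul_eq_zero.1 h3).resolve_left (mul_pos (hWpos k l) (hπ l)).ne'
      linarith
    have h4 := horth i₀ i₀
    simp only [hall, if_true] at h4
    rw [← Finset.sum_mul, h1, one_mul] at h4
    intro a b
    rw [hall a, hall b, h4]
  refine ⟨fun i => if i = i₀ then 0 else ρ i, φ, horth, fun k l => ?_, fun i => ?_⟩
  · rw [hexp, ← Finset.add_sum_erase _ _ (Finset.mem_univ i₀), hρ0, hconst,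
      ← Finset.add_sum_erase Finset.univ (fun i => (if i = i₀ then 0 else ρ i) * _)
        (Finset.mem_univ i₀)]
    simp only [if_true, zero_mul, zero_add, mul_one, add_sub_cancel_left]
    exact Finset.sum_congr rfl fun i hi => by rw [if_neg (Finset.ne_of_mem_erase hi)]
  · have hroots : ((Matrix.diagonal π * W).map (algebraMap ℝ ℂ)).charpoly.roots.map
        (fun z : ℂ => ‖z‖) = Finset.univ.val.map fun i => |ρ i| := by
      rw [Matrix.charpoly_map, hchar, Polynomial.map_prod]
      simp only [Polynomial.map_sub, Polynomial.map_X, Polynomial.map_C]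
      have : ∏ i, (Polynomial.X - Polynomial.C (algebraMap ℝ ℂ (ρ i))) =
          ((Finset.univ.val.map fun i => algebraMap ℝ ℂ (ρ i)).map
            fun a => Polynomial.X - Polynomial.C a).prod := by
        rw [Multiset.map_map]
        rfl
      rw [this, Polynomial.roots_multiset_prod_X_sub_C, Multiset.map_map]
      refine Multiset.map_congr rfl fun i _ => ?_
      simp
    have key : ∀ j, j ≠ i₀ → |ρ j| ≤ secondEigenvalueAbs (Matrix.diagonal π * W) := by
      intro j hj
      refine le_getD_one_sort (a := |ρ i₀|)
        (s := ((Finset.univ.erase i₀).erase j).val.map fun i => |ρ i|) ?_ ?_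
      · rw [hroots, ← Multiset.map_cons (fun i => |ρ i|) j, ← Multiset.map_cons (fun i => |ρ i|) i₀]
        congr 1
        rw [← Finset.insert_val_of_notMem (Finset.notMem_erase _ _),
          Finset.insert_erase (Finset.mem_erase.2 ⟨hj, Finset.mem_univ j⟩),
          ← Finset.insert_val_of_notMem (Finset.notMem_erase _ _),
          Finset.insert_erase (Finset.mem_univ _)]
      · rw [hρ0, abs_one]
        exact hρ1 j
    by_cases hi : i = i₀
    -- The removed eigenvalue has become 0, so only nonnegativity is needed; with a single label
    -- this is the default value 0.
    · have h2 : 0 ≤ secondEigenvalueAbs (Matrix.diagonal π * W) := by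
        by_cases hj : ∃ j, j ≠ i₀
        · obtain ⟨j, hj⟩ := hj
          exact (abs_nonneg _).trans (key j hj)
        · push Not at hj
          have huniv : (Finset.univ : Finset (Fin q)) = {i₀} := by
            ext j
            simp [hj j]
          unfold secondEigenvalueAbs
          rw [hroots, huniv]
          simp
      simpa [hi] using h2
    · simpa [hi] using key i hi

end Spectral

/-! ### Duality, and expansion in products centred given the labels. -/

section Duality

variable {q n : ℕ} {π : Fin q → ℝ} {Q : Matrix (Fin q) (Fin q) ℝ}

/-- The conditional probability of the graph given the labels. -/
noncomputable def graphProb (P : Fin q → Fin q → ℝ) (σ : Fin n → Fin q) (Y : Edge n → Bool) : ℝ :=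
  ∏ e : Edge n, (if Y e = true then P (σ e.1.1) (σ e.1.2) else 1 - P (σ e.1.1) (σ e.1.2))

/-- The entries of the adjacency matrix as real numbers. -/
def entry (Y : Edge n → Bool) (e : Edge n) : ℝ := if Y e = true then 1 else 0

lemma sum_graphProb_mul_prod (P : Fin q → Fin q → ℝ) (σ : Fin n → Fin q)
    (g : Edge n → Bool → ℝ) :
    ∑ Y, graphProb P σ Y * ∏ e, g e (Y e) =
      ∏ e : Edge n, (P (σ e.1.1) (σ e.1.2) * g e true +
        (1 - P (σ e.1.1) (σ e.1.2)) * g e false) := by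
  have := Finset.prod_univ_sum (fun _ : Edge n => (Finset.univ : Finset Bool))
    (fun e y => (if y = true then P (σ e.1.1) (σ e.1.2) else 1 - P (σ e.1.1) (σ e.1.2)) * g e y)
  rw [Fintype.piFinset_univ] at this
  simp only [graphProb, ← Finset.prod_mul_distrib]
  rw [← this]
  refine Finset.prod_congr rfl fun e _ => ?_
  simp

lemma expect_eq_mean (F : (Fin n → Fin q) → (Edge n → Bool) → ℝ) :
    expect π Q n F = mean π (fun σ => ∑ Y, graphProb (fun k l => Q k l / n) σ Y * F σ Y) := by
  simp only [expect, mean, prob, graphProb, Finset.mul_sum, mul_assoc]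

lemma expect_sum {ι : Type*} (s : Finset ι) (F : ι → (Fin n → Fin q) → (Edge n → Bool) → ℝ) :
    expect π Q n (fun σ Y => ∑ i ∈ s, F i σ Y) = ∑ i ∈ s, expect π Q n (F i) := by
  simp only [expect, Finset.mul_sum]
  rw [Finset.sum_comm]
  rw [Finset.sum_congr rfl fun Y _ => Finset.sum_comm]
  rw [Finset.sum_comm]
  exact Finset.sum_congr rfl fun _ _ => Finset.sum_comm

lemma expect_mul_left (c : ℝ) (F : (Fin n → Fin q) → (Edge n → Bool) → ℝ) :
    expect π Q n (fun σ Y => c * F σ Y) = c * expect π Q n F := by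
  simp only [expect, Finset.mul_sum]
  exact Finset.sum_congr rfl fun _ _ => Finset.sum_congr rfl fun _ _ => by ring

lemma expect_sub (F G : (Fin n → Fin q) → (Edge n → Bool) → ℝ) :
    expect π Q n (fun σ Y => F σ Y - G σ Y) = expect π Q n F - expect π Q n G := by
  simp only [expect, mul_sub, Finset.sum_sub_distrib]

lemma prob_nonneg (hπ : ∀ k, 0 ≤ π k) (hQ0 : ∀ k l, 0 ≤ Q k l) (hQn : ∀ k l, Q k l ≤ n)
    (σ : Fin n → Fin q) (Y : Edge n → Bool) : 0 ≤ prob π Q n σ Y := by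
  refine mul_nonneg (Finset.prod_nonneg fun _ _ => hπ _) (Finset.prod_nonneg fun e _ => ?_)
  split_ifs
  · exact div_nonneg (hQ0 _ _) (Nat.cast_nonneg n)
  · exact sub_nonneg.2 (div_le_one_of_le₀ (hQn _ _) (Nat.cast_nonneg n))

/-- The Cauchy–Schwarz inequality under the stochastic block model. -/
lemma expect_mul_sq_le (hπ : ∀ k, 0 ≤ π k) (hQ0 : ∀ k l, 0 ≤ Q k l) (hQn : ∀ k l, Q k l ≤ n)
    (F G : (Fin n → Fin q) → (Edge n → Bool) → ℝ) :
    expect π Q n (fun σ Y => F σ Y * G σ Y) ^ 2 ≤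
      expect π Q n (fun σ Y => F σ Y ^ 2) * expect π Q n (fun σ Y => G σ Y ^ 2) := by
  simp only [expect, ← Finset.sum_product']
  have hp := prob_nonneg hπ hQ0 hQn
  exact Finset.sum_sq_le_sum_mul_sum_of_sq_le_mul _
    (fun p _ => mul_nonneg (hp p.1 p.2) (sq_nonneg _))
    (fun p _ => mul_nonneg (hp p.1 p.2) (sq_nonneg _)) fun p _ => le_of_eq (by ring)

/-- The degree-`D` correlation is bounded by the norm of any function with the same correlations
with the polynomials of degree at most `D`. -/
lemma corr_le_sqrt (hπ : ∀ k, 0 ≤ π k) (hQ0 : ∀ k l, 0 ≤ Q k l) (hQn : ∀ k l, Q k l ≤ n)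
    {u v : Fin n} {k l : Fin q} {D : ℕ} (G : (Fin n → Fin q) → (Edge n → Bool) → ℝ)
    (hG : ∀ f : MvPolynomial (Edge n) ℝ, f.totalDegree ≤ D →
      expect π Q n (fun σ Y => evalGraph f Y * estimand π u v k l σ) =
        expect π Q n (fun σ Y => evalGraph f Y * G σ Y)) {b : ℝ}
    (hb : expect π Q n (fun σ Y => G σ Y ^ 2) ≤ b) :
    corr π Q u v k l D ≤ ((√b : ℝ) : EReal) := by
  refine iSup_le fun ⟨f, hf, hpos⟩ => ?_
  rw [EReal.coe_le_coe_iff, div_le_iff₀ (Real.sqrt_pos.2 hpos)]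
  simp only
  rw [hG f hf]
  have h := expect_mul_sq_le hπ hQ0 hQn (fun _ Y => evalGraph f Y) G
  refine (le_abs_self _).trans ?_
  rw [← Real.sqrt_sq_eq_abs, ← Real.sqrt_mul' _ hpos.le, mul_comm b]
  exact Real.sqrt_le_sqrt (h.trans (mul_le_mul_of_nonneg_left hb hpos.le))

/-- The product of the entries of the graph, centred at `c`, over the edges of `α`. -/
noncomputable def centredProd (c : ℝ) (α : Finset (Edge n)) (Y : Edge n → Bool) : ℝ :=
  ∏ e ∈ α, (entry Y e - c)

/-- A function orthogonal to the centred products of at most `D` entries is orthogonal to the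
polynomials of degree at most `D`. -/
lemma expect_evalGraph_mul_eq_zero (c : ℝ) {D : ℕ}
    {G : (Fin n → Fin q) → (Edge n → Bool) → ℝ}
    (hG : ∀ α : Finset (Edge n), α.card ≤ D →
      expect π Q n (fun σ Y => centredProd c α Y * G σ Y) = 0)
    {f : MvPolynomial (Edge n) ℝ} (hf : f.totalDegree ≤ D) :
    expect π Q n (fun σ Y => evalGraph f Y * G σ Y) = 0 := by
  classical
  have h1 : ∀ Y, evalGraph f Y = ∑ m ∈ f.support, ∑ t ∈ m.support.powerset,
      (f.coeff m * c ^ (m.support \ t).card) * centredProd c t Y := by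
    intro Y
    rw [evalGraph, MvPolynomial.eval_eq]
    refine Finset.sum_congr rfl fun m _ => ?_
    -- Entries are 0 or 1, so positive powers collapse and every monomial is multilinear.
    have h2 : ∏ e ∈ m.support, (if Y e = true then (1 : ℝ) else 0) ^ m e =
        ∏ e ∈ m.support, ((entry Y e - c) + c) := by
      refine Finset.prod_congr rfl fun e he => ?_
      rw [sub_add_cancel, entry]
      split_ifs
      · rw [one_pow]
      · rw [zero_pow (Finsupp.mem_support_iff.1 he)]
    rw [h2, Finset.prod_add, Finset.mul_sum]
    refine Finset.sum_congr rfl fun t _ => ?_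
    rw [Finset.prod_const, centredProd]
    ring
  simp only [h1, Finset.sum_mul, mul_assoc]
  rw [expect_sum]
  refine Finset.sum_eq_zero fun m hm => ?_
  rw [expect_sum]
  refine Finset.sum_eq_zero fun t ht => ?_
  rw [expect_mul_left, expect_mul_left, hG t, mul_zero, mul_zero]
  calc t.card ≤ m.support.card := Finset.card_le_card (Finset.mem_powerset.1 ht)
    _ ≤ m.sum fun _ k => k := by
        rw [Finsupp.sum, Finset.card_eq_sum_ones]
        exact Finset.sum_le_sum fun e he => Nat.one_le_iff_ne_zero.2 (Finsupp.mem_support_iff.1 he)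
    _ ≤ f.totalDegree := MvPolynomial.le_totalDegree hm
    _ ≤ D := hf

/-- The product of the entries of the graph, centred given the labels, over the edges of `β`. -/
noncomputable def noiseProd (P : Fin q → Fin q → ℝ) (β : Finset (Edge n)) (σ : Fin n → Fin q)
    (Y : Edge n → Bool) : ℝ :=
  ∏ e ∈ β, (entry Y e - P (σ e.1.1) (σ e.1.2))

/-- Given the labels the edges are independent. An edge of `β` outside `α` has mean zero, an edge of
both gives the variance `P (1 - P)`, and an edge of `α` alone gives the bias `P - c`. This is what
makes the system triangular. -/
lemma sum_graphProb_mul_centredProd (P : Fin q → Fin q → ℝ) (c : ℝ) (β α : Finset (Edge n))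
    (σ : Fin n → Fin q) :
    ∑ Y, graphProb P σ Y * (centredProd c α Y * noiseProd P β σ Y) =
      if β ⊆ α then edgeProd (fun k l => P k l * (1 - P k l)) β σ *
        edgeProd (fun k l => P k l - c) (α \ β) σ else 0 := by
  have h := sum_graphProb_mul_prod P σ (fun e y =>
    (if e ∈ α then (if y = true then (1 : ℝ) else 0) - c else 1) *
      (if e ∈ β then (if y = true then (1 : ℝ) else 0) - P (σ e.1.1) (σ e.1.2) else 1))
  simp only [Finset.prod_mul_distrib, Fintype.prod_ite_mem] at h
  simp only [centredProd, noiseProd, entry]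
  rw [h]
  by_cases hβ : β ⊆ α
  · rw [if_pos hβ]
    simp only [edgeProd]
    rw [← Fintype.prod_ite_mem β, ← Fintype.prod_ite_mem (α \ β), ← Finset.prod_mul_distrib]
    refine Finset.prod_congr rfl fun e _ => ?_
    have := @hβ e
    by_cases h1 : e ∈ β <;> by_cases h2 : e ∈ α <;> simp_all <;> ring
  · rw [if_neg hβ]
    obtain ⟨e, he, heα⟩ := Finset.not_subset.1 hβ
    refine Finset.prod_eq_zero (Finset.mem_univ e) ?_
    simp [he, heα]
    ring

lemma sum_graphProb_mul_noiseProd (P : Fin q → Fin q → ℝ) (β β' : Finset (Edge n))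
    (σ : Fin n → Fin q) :
    ∑ Y, graphProb P σ Y * (noiseProd P β σ Y * noiseProd P β' σ Y) =
      if β = β' then edgeProd (fun k l => P k l * (1 - P k l)) β σ else 0 := by
  have h := sum_graphProb_mul_prod P σ (fun e y =>
    (if e ∈ β then (if y = true then (1 : ℝ) else 0) - P (σ e.1.1) (σ e.1.2) else 1) *
      (if e ∈ β' then (if y = true then (1 : ℝ) else 0) - P (σ e.1.1) (σ e.1.2) else 1))
  simp only [Finset.prod_mul_distrib, Fintype.prod_ite_mem] at h
  simp only [noiseProd, entry]
  rw [h]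
  by_cases hβ : β = β'
  · rw [if_pos hβ]
    subst hβ
    simp only [edgeProd]
    rw [← Fintype.prod_ite_mem β]
    refine Finset.prod_congr rfl fun e _ => ?_
    by_cases h1 : e ∈ β <;> simp [h1]; ring
  · rw [if_neg hβ]
    have hne : ∃ e, ¬ (e ∈ β ↔ e ∈ β') := by
      by_contra! hcon
      exact hβ (Finset.ext hcon)
    obtain ⟨e, he⟩ := hne
    refine Finset.prod_eq_zero (Finset.mem_univ e) ?_
    by_cases h1 : e ∈ β <;> by_cases h2 : e ∈ β' <;> simp_all <;> ring

lemma sum_graphProb (P : Fin q → Fin q → ℝ) (σ : Fin n → Fin q) :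
    ∑ Y, graphProb P σ Y = 1 := by
  simpa [noiseProd, edgeProd] using sum_graphProb_mul_noiseProd P ∅ ∅ σ

lemma abs_estimand_le (hπ : ∀ k, 0 < π k) (h1 : ∑ k, π k = 1) (u v : Fin n) (k l : Fin q)
    (σ : Fin n → Fin q) : |estimand π u v k l σ| ≤ 1 := by
  have hle : ∀ k, π k ≤ 1 := fun k => by
    rw [← h1]
    exact Finset.single_le_sum (fun i _ => (hπ i).le) (Finset.mem_univ k)
  have key : ∀ (w : Fin n) (k : Fin q), |(if σ w = k then (1 : ℝ) else 0) - π k| ≤ 1 := by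
    intro w k
    have h2 := hle k
    have h3 := hπ k
    rw [abs_le]
    split_ifs <;> constructor <;> linarith
  rw [estimand, abs_mul]
  exact mul_le_one₀ (key u k) (abs_nonneg _) (key v l)

/-- The correlation never exceeds one. -/
lemma corr_le_one (hπ : ∀ k, 0 < π k) (h1 : ∑ k, π k = 1) (hQ0 : ∀ k l, 0 ≤ Q k l)
    (hQn : ∀ k l, Q k l ≤ n) (u v : Fin n) (k l : Fin q) (D : ℕ) :
    corr π Q u v k l D ≤ ((√1 : ℝ) : EReal) := by
  refine corr_le_sqrt (fun k => (hπ k).le) hQ0 hQn (fun σ _ => estimand π u v k l σ)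
    (fun _ _ => rfl) ?_
  rw [expect_eq_mean]
  simp only [← Finset.sum_mul, sum_graphProb, one_mul]
  refine (mean_mono (fun k => (hπ k).le) fun σ => ?_).trans_eq (mean_one h1)
  rw [← sq_abs]
  exact pow_le_one₀ (abs_nonneg _) (abs_estimand_le hπ h1 u v k l σ)

lemma expect_centredProd_mul_labels (c : ℝ) (α : Finset (Edge n)) (x : (Fin n → Fin q) → ℝ) :
    expect π Q n (fun σ Y => centredProd c α Y * x σ) =
      mean π (fun σ => x σ * edgeProd (fun k l => Q k l / n - c) α σ) := by
  rw [expect_eq_mean]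
  congr 1
  ext σ
  have := sum_graphProb_mul_centredProd (fun k l => Q k l / n) c ∅ α σ
  simp only [noiseProd, Finset.prod_empty, mul_one, Finset.empty_subset, if_true,
    Finset.sdiff_empty, edgeProd, one_mul] at this
  simp only [← mul_assoc, ← Finset.sum_mul, this, edgeProd]
  ring

/-- The bound on the correlation by the coefficients that solve the moment equations. -/
lemma corr_le_sqrt_sum_coef (hπ : ∀ k, 0 < π k) (h1 : ∑ k, π k = 1) (hQ : Q.IsSymm)
    (hQ0 : ∀ k l, 0 ≤ Q k l) (hQn : ∀ k l, Q k l ≤ n) {d : ℝ}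
    (hdeg : ∀ k, ∑ l, Q k l * π l = d) {u v : Fin n} (huv : u ≠ v)
    (hN : ∀ β : Finset (Edge n), mean π (edgeProd (fun k l => Q k l / n * (1 - Q k l / n)) β) ≠ 0)
    (k l : Fin q) (D : ℕ) :
    corr π Q u v k l D ≤ ((√(∑ β ∈ Finset.univ.filter fun β : Finset (Edge n) => β.card ≤ D,
      coef u v π (fun k l => Q k l / n * (1 - Q k l / n)) (fun k l => Q k l / n - d / n)
        (estimand π u v k l) β ^ 2 /
          mean π (edgeProd (fun k l => Q k l / n * (1 - Q k l / n)) β)) : ℝ) : EReal) := by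
  set A : Fin q → Fin q → ℝ := fun k l => Q k l / n * (1 - Q k l / n) with hA
  set B : Fin q → Fin q → ℝ := fun k l => Q k l / n - d / n with hB
  set x := estimand π u v k l
  set S := Finset.univ.filter fun β : Finset (Edge n) => β.card ≤ D
  have hBl : ∀ k, ∑ l, π l * B k l = 0 := by
    intro k
    have : ∑ l, π l * B k l = (∑ l, Q k l * π l) / n - (∑ l, π l) * (d / n) := by
      rw [Finset.sum_div, Finset.sum_mul, ← Finset.sum_sub_distrib]
      exact Finset.sum_congr rfl fun l _ => by simp only [hB]; ring
    rw [this, hdeg, h1, one_mul, sub_self]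
  have hBr : ∀ l, ∑ k, π k * B k l = 0 := by
    intro l
    rw [← hBl l]
    exact Finset.sum_congr rfl fun k _ => by simp only [hB, hQ.apply l k]
  have hcentred : ∀ k : Fin q, ∑ a, π a * ((if a = k then (1 : ℝ) else 0) - π k) = 0 := by
    intro k
    simp [mul_sub, Finset.sum_sub_distrib, ← Finset.sum_mul, h1]
  have hsolve := sum_coef_mul_mixedMoment huv h1 hN hBl hBr (hcentred k) (hcentred l)
    (x := x) (fun σ => rfl)
  let G : (Fin n → Fin q) → (Edge n → Bool) → ℝ := fun σ Y =>
    ∑ β ∈ S, coef u v π A B x β / mean π (edgeProd A β) *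
      noiseProd (fun k l => Q k l / n) β σ Y
  refine corr_le_sqrt (fun k => (hπ k).le) hQ0 hQn G (fun f hf => ?_) (le_of_eq ?_)
  · rw [← sub_eq_zero, ← expect_sub]
    simp only [← mul_sub]
    refine expect_evalGraph_mul_eq_zero (d / n) (fun α hα => ?_) hf
    simp only [mul_sub]
    rw [expect_sub, expect_centredProd_mul_labels, sub_eq_zero, ← hsolve α]
    simp only [G, Finset.mul_sum, mul_left_comm (centredProd _ _ _)]
    rw [expect_sum]
    have hterm : ∀ β ∈ S, expect π Q n (fun σ Y => coef u v π A B x β / mean π (edgeProd A β) *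
        (centredProd (d / n) α Y * noiseProd (fun k l => Q k l / n) β σ Y)) =
        if β ⊆ α then coef u v π A B x β / mean π (edgeProd A β) * mixedMoment π A B β α
          else 0 := by
      intro β _
      rw [expect_mul_left, expect_eq_mean]
      simp only [sum_graphProb_mul_centredProd]
      split_ifs with h
      · rfl
      · simp [mean]
    -- Truncation at `D` edges loses nothing: only `β ⊆ α` survive, and `α` has at most `D` edges.
    rw [Finset.sum_congr rfl hterm, ← Finset.sum_filter]
    refine Finset.sum_congr ?_ fun _ _ => rfl
    ext β
    simp only [S, Finset.mem_filter, Finset.mem_univ, true_and, Finset.mem_powerset]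
    exact ⟨fun h => ⟨(Finset.card_le_card h).trans hα, h⟩, fun h => h.2⟩
  · have hsq : ∀ σ Y, G σ Y ^ 2 = ∑ β ∈ S, ∑ β' ∈ S,
        (coef u v π A B x β / mean π (edgeProd A β) *
          (coef u v π A B x β' / mean π (edgeProd A β'))) *
          (noiseProd (fun k l => Q k l / n) β σ Y * noiseProd (fun k l => Q k l / n) β' σ Y) := by
      intro σ Y
      rw [sq, Finset.sum_mul_sum]
      exact Finset.sum_congr rfl fun _ _ => Finset.sum_congr rfl fun _ _ => by ring
    simp only [hsq]
    rw [expect_sum]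
    refine Finset.sum_congr rfl fun β hβ => ?_
    rw [expect_sum, Finset.sum_eq_single_of_mem β hβ]
    · rw [expect_mul_left, expect_eq_mean]
      simp only [sum_graphProb_mul_noiseProd, if_true]
      have := hN β
      change _ * mean π (edgeProd A β) = _
      field_simp
    · intro β' _ hne
      rw [expect_mul_left, expect_eq_mean]
      simp only [sum_graphProb_mul_noiseProd, if_neg hne.symm]
      simp [mean]

end Duality

/-! ### Summation over edge number and excess. -/

section Summation

variable {n : ℕ}

/-- For `k ≥ 2`, count and weight combine into `g ^ k`: bounding `D + 2` by `3 D`, one has `(3 D) ^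
3 * (4 (2 D) ^ 6) ^ 2 = 1769472 D ^ 15`. Two factors `g` give order `1 / n` through `D ^ 30 ≤ n`,
and the others are at most `1 / 2` each. Excess one uses the sharper count. -/
lemma sum_admissibleSet_le {u v : Fin n} (huv : u ≠ v) {D : ℕ} (hD1 : 1 ≤ D)
    (hDn : (D : ℝ) ^ 30 ≤ n) {F : Finset (Edge n) → ℝ} {E s : ℝ} (hE : 0 ≤ E) (hs : 0 ≤ s)
    (hn : 4 * (1769472 * E) ^ 2 ≤ n)
    (hF : ∀ α, Admissible u v α → α.card ≤ D → F α ≤ 2 * (s / n) ^ α.card *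
      (E ^ excess u v α * ((4 * (2 * D) ^ 6) ^ 2) ^ (excess u v α - 1)))
    {e k : ℕ} (he1 : 1 ≤ e) (heD : e ≤ D) :
    ∑ α ∈ admissibleSet u v e k, F α ≤
      8 * (E + (1769472 * E) ^ 2) / n * s ^ e * (1 / 2) ^ k := by
  have hD1' : (1 : ℝ) ≤ D := by exact_mod_cast hD1
  have hn1 : (1 : ℝ) ≤ n := (one_le_pow₀ hD1').trans hDn
  have hn0 : (0 : ℝ) < n := by linarith
  set X : ℝ := (4 * (2 * D) ^ 6) ^ 2 with hX
  have hX1 : 1 ≤ X := by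
    rw [hX]
    refine one_le_pow₀ ?_
    have := one_le_pow₀ (n := 6) (show (1 : ℝ) ≤ 2 * D by linarith)
    linarith
  have hsum : ∑ α ∈ admissibleSet u v e k, F α ≤
      (admissibleSet u v e k).card * (2 * (s / n) ^ e * (E ^ k * X ^ (k - 1))) := by
    rw [← nsmul_eq_mul]
    refine Finset.sum_le_card_nsmul _ _ _ fun α hα => ?_
    obtain ⟨hadm, rfl, rfl⟩ := mem_admissibleSet.1 hα
    exact hF α hadm heD
  refine hsum.trans ?_
  rcases Nat.lt_trichotomy k 1 with hk | rfl | hk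
  · obtain rfl : k = 0 := by omega
    have : admissibleSet u v e 0 = ∅ := by
      rw [Finset.eq_empty_iff_forall_notMem]
      intro α hα
      obtain ⟨hadm, -, h0⟩ := mem_admissibleSet.1 hα
      exact (excess_pos hadm).ne' h0
    rw [this, Finset.card_empty, Nat.cast_zero, zero_mul]
    positivity
  · obtain ⟨i, rfl⟩ : ∃ i, e = i + 1 := ⟨e - 1, by omega⟩
    have hc : ((admissibleSet u v (i + 1) 1).card : ℝ) ≤ (n : ℝ) ^ i := by
      exact_mod_cast card_admissibleSet_one_le huv i
    calc ((admissibleSet u v (i + 1) 1).card : ℝ) *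
          (2 * (s / n) ^ (i + 1) * (E ^ 1 * X ^ (1 - 1)))
        ≤ (n : ℝ) ^ i * (2 * (s / n) ^ (i + 1) * (E ^ 1 * X ^ (1 - 1))) := by gcongr
      _ = 2 * E / n * s ^ (i + 1) := by
          rw [div_pow, Nat.sub_self, pow_zero, pow_succ (n : ℝ)]
          field_simp
      _ ≤ 4 * (E + (1769472 * E) ^ 2) / n * s ^ (i + 1) := by
          have h8 : 2 * E ≤ 4 * (E + (1769472 * E) ^ 2) := by
            linarith [sq_nonneg (1769472 * E)]
          exact mul_le_mul_of_nonneg_right (div_le_div_of_nonneg_right h8 hn0.le) (by positivity)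
      _ = _ := by ring
  · have hc : ((admissibleSet u v e k).card : ℝ) * (n : ℝ) ^ k ≤
        (n : ℝ) ^ e * ((D : ℝ) + 2) ^ (3 * k) := by
      exact_mod_cast card_admissibleSet_le u v heD k
    set g : ℝ := 1769472 * E * D ^ 15 / n with hg
    have hg0 : 0 ≤ g := by positivity
    have hg2 : g ^ 2 ≤ (1769472 * E) ^ 2 / n := by
      rw [hg, div_pow, mul_pow, ← pow_mul, div_le_div_iff₀ (by positivity) hn0]
      calc (1769472 * E) ^ 2 * (D : ℝ) ^ (15 * 2) * n ≤ (1769472 * E) ^ 2 * n * n := by gcongr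
        _ = _ := by ring
    have hghalf : g ≤ 1 / 2 := by
      have h4 : g ^ 2 ≤ (1 / 2) ^ 2 := by
        refine hg2.trans ?_
        rw [div_le_iff₀ hn0]
        linarith
      exact le_of_sq_le_sq h4 (by norm_num)
    have hgk : g ^ k ≤ (1769472 * E) ^ 2 / n * (4 * (1 / 2) ^ k) := by
      obtain ⟨j, rfl⟩ : ∃ j, k = j + 2 := ⟨k - 2, by omega⟩
      calc g ^ (j + 2) = g ^ 2 * g ^ j := by ring
        _ ≤ (1769472 * E) ^ 2 / n * (1 / 2) ^ j := by gcongr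
        _ = _ := by ring
    have hcount : ((admissibleSet u v e k).card : ℝ) ≤
        (n : ℝ) ^ e * ((3 * (D : ℝ)) ^ 3 / n) ^ k := by
      rw [div_pow, ← mul_div_assoc, le_div_iff₀ (by positivity), ← pow_mul]
      refine hc.trans ?_
      gcongr
      linarith
    calc ((admissibleSet u v e k).card : ℝ) * (2 * (s / n) ^ e * (E ^ k * X ^ (k - 1)))
        ≤ ((n : ℝ) ^ e * ((3 * (D : ℝ)) ^ 3 / n) ^ k) *
            (2 * (s / n) ^ e * (E ^ k * X ^ k)) := by
          gcongr
          omega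
      _ = 2 * s ^ e * ((3 * (D : ℝ)) ^ 3 / n * E * X) ^ k := by
          rw [div_pow s, mul_pow ((3 * (D : ℝ)) ^ 3 / n * E), mul_pow ((3 * (D : ℝ)) ^ 3 / n) E]
          field_simp
      _ = 2 * s ^ e * g ^ k := by
          congr 2
          rw [hg, hX]
          ring
      _ ≤ 2 * s ^ e * ((1769472 * E) ^ 2 / n * (4 * (1 / 2) ^ k)) := by gcongr
      _ = 8 * (0 + (1769472 * E) ^ 2) / n * s ^ e * (1 / 2) ^ k := by ring
      _ ≤ _ := by gcongr

lemma sum_le_of_admissible {u v : Fin n} (huv : u ≠ v) {D : ℕ} (hD1 : 1 ≤ D)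
    (hDn : (D : ℝ) ^ 30 ≤ n) {F : Finset (Edge n) → ℝ} {E s : ℝ} (hE : 0 ≤ E) (hs : 0 ≤ s)
    (hn : 4 * (1769472 * E) ^ 2 ≤ n) (hF0 : ∀ α, ¬ Admissible u v α → F α = 0)
    (hF : ∀ α, Admissible u v α → α.card ≤ D → F α ≤ 2 * (s / n) ^ α.card *
      (E ^ excess u v α * ((4 * (2 * D) ^ 6) ^ 2) ^ (excess u v α - 1))) :
    ∑ α ∈ Finset.univ.filter (fun α : Finset (Edge n) => α.card ≤ D), F α ≤
      16 * (E + (1769472 * E) ^ 2) / n * ∑ t ∈ Finset.Icc 1 D, s ^ t := by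
  classical
  have h1 : ∑ α ∈ Finset.univ.filter (fun α : Finset (Edge n) => α.card ≤ D), F α =
      ∑ α ∈ Finset.univ.filter (fun α : Finset (Edge n) => α.card ≤ D ∧ Admissible u v α),
        F α := by
    rw [← Finset.filter_filter]
    refine (Finset.sum_filter_of_ne fun α _ hne => ?_).symm
    by_contra hadm
    exact hne (hF0 α hadm)
  rw [h1, ← Finset.sum_fiberwise_of_maps_to
    (t := Finset.Icc 1 D ×ˢ Finset.range (D + 1)) (g := fun α => (α.card, excess u v α))]
  · rw [Finset.sum_product, Finset.mul_sum]
    refine Finset.sum_le_sum fun e he => ?_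
    obtain ⟨he1, heD⟩ := Finset.mem_Icc.1 he
    have h2 : ∀ k, (Finset.univ.filter fun α : Finset (Edge n) =>
        α.card ≤ D ∧ Admissible u v α).filter (fun α => (α.card, excess u v α) = (e, k)) =
        admissibleSet u v e k := by
      intro k
      ext α
      simp only [Finset.mem_filter, Finset.mem_univ, true_and, mem_admissibleSet, Prod.mk.injEq]
      exact ⟨fun h => ⟨h.1.2, h.2.1, h.2.2⟩, fun h => ⟨⟨h.2.1.le.trans heD, h.1⟩, h.2.1, h.2.2⟩⟩
    simp only [h2]
    calc ∑ k ∈ Finset.range (D + 1), ∑ α ∈ admissibleSet u v e k, F α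
        ≤ ∑ k ∈ Finset.range (D + 1),
            8 * (E + (1769472 * E) ^ 2) / n * s ^ e * (1 / 2) ^ k :=
          Finset.sum_le_sum fun k _ => sum_admissibleSet_le huv hD1 hDn hE hs hn hF he1 heD
      _ = 8 * (E + (1769472 * E) ^ 2) / n * s ^ e *
            ∑ k ∈ Finset.range (D + 1), (1 / 2) ^ k := by rw [Finset.mul_sum]
      _ ≤ 8 * (E + (1769472 * E) ^ 2) / n * s ^ e * 2 := by
          gcongr
          exact sum_geometric_two_le (D + 1)
      _ = _ := by ring
  · intro α hα
    obtain ⟨-, hαD, hadm⟩ := Finset.mem_filter.1 hα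
    have h3 := excess_pos hadm
    have h4 : excess u v α ≤ α.card := excess_le_card
    rw [Finset.mem_product, Finset.mem_Icc, Finset.mem_range]
    simp only
    omega

end Summation

/-! ### Lower bound on the norms, and the conclusion. -/

section Main

variable {q n : ℕ} {π : Fin q → ℝ} {Q : Matrix (Fin q) (Fin q) ℝ}

lemma mean_pos [Nonempty (Fin n → Fin q)] (hπ : ∀ k, 0 < π k) {F : (Fin n → Fin q) → ℝ}
    (hF : ∀ σ, 0 < F σ) : 0 < mean π F :=
  Finset.sum_pos (fun σ _ => mul_pos (Finset.prod_pos fun _ _ => hπ _) (hF σ))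
    Finset.univ_nonempty

lemma mean_estimand (h1 : ∑ k, π k = 1) {u v : Fin n} (huv : u ≠ v) (k l : Fin q) :
    mean π (estimand π u v k l) = 0 := by
  have hcentred : ∑ a, π a * ((if a = k then (1 : ℝ) else 0) - π k) = 0 := by
    simp [mul_sub, Finset.sum_sub_distrib, ← Finset.sum_mul, h1]
  have h := mean_mul_of_disjoint (V := Fin n) (π := π) h1
    (F := fun σ => (if σ u = k then (1 : ℝ) else 0) - π k)
    (G := fun σ => (if σ v = l then (1 : ℝ) else 0) - π l) (A := {u}) (B := {v})
    (fun σ τ h => by simp only [h u (Finset.mem_singleton_self u)])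
    (fun σ τ h => by simp only [h v (Finset.mem_singleton_self v)]) (by simpa using huv)
  rw [mean_single h1 u (fun a => (if a = k then (1 : ℝ) else 0) - π k), hcentred, zero_mul] at h
  exact h

/-- The correlation vanishes when no centred product correlates with the estimand. -/
lemma corr_le_zero (hπ : ∀ k, 0 ≤ π k) (hQ0 : ∀ k l, 0 ≤ Q k l) (hQn : ∀ k l, Q k l ≤ n)
    (c : ℝ) {u v : Fin n} {k l : Fin q} {D : ℕ}
    (h : ∀ α : Finset (Edge n), α.card ≤ D → mean π (fun σ => estimand π u v k l σ *
      edgeProd (fun k l => Q k l / n - c) α σ) = 0) :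
    corr π Q u v k l D ≤ ((√0 : ℝ) : EReal) := by
  refine corr_le_sqrt hπ hQ0 hQn (fun _ _ => 0) (fun f hf => ?_) ?_
  · rw [expect_evalGraph_mul_eq_zero c (G := fun σ _ => estimand π u v k l σ) (fun α hα => ?_) hf]
    · simp [expect]
    · rw [expect_centredProd_mul_labels, h α hα]
  · simp [expect]

/-- The growth gives `m` to the power of the excess for the stochastic kernel; the factors `1 - b`
lose at most one half in total, by Bernoulli's inequality. -/
lemma le_mean_edgeProd (hπ : ∀ k, 0 ≤ π k) (h1 : ∑ k, π k = 1) {W : Fin q → Fin q → ℝ}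
    (hl : ∀ k, ∑ l, π l * W k l = 1) (hr : ∀ l, ∑ k, π k * W k l = 1) {m : ℝ} (hm : 0 ≤ m)
    (hW : ∀ k l, m ≤ W k l) {A : Fin q → Fin q → ℝ} {a b : ℝ} (ha : 0 ≤ a) (hb : b ≤ 1)
    (hA : ∀ k l, a * (1 - b) * W k l ≤ A k l) {u v : Fin n} {D : ℕ} (hbD : D * b ≤ 1 / 2)
    (hb0 : 0 ≤ b) {α : Finset (Edge n)} (hα : Admissible u v α) (hD : α.card ≤ D) :
    a ^ α.card * m ^ excess u v α / 2 ≤ mean π (edgeProd A α) := by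
  obtain ⟨h, hg⟩ := hα.grown
  have h2 := hg.pow_le_mean_prod hπ h1 hm hW hl hr
  have h3 : (1 : ℝ) / 2 ≤ (1 - b) ^ α.card := by
    have := one_add_mul_le_pow (show (-2 : ℝ) ≤ -b by linarith) α.card
    have hcard : (α.card : ℝ) * b ≤ D * b :=
      mul_le_mul_of_nonneg_right (by exact_mod_cast hD) hb0
    rw [← sub_eq_add_neg] at this
    linarith
  calc a ^ α.card * m ^ excess u v α / 2 = a ^ α.card * (1 / 2) * m ^ excess u v α := by ring
    _ ≤ a ^ α.card * (1 - b) ^ α.card *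
          mean π (fun σ : Fin n → Fin q => ∏ e ∈ α, W (σ e.1.1) (σ e.1.2)) := by gcongr
    _ = mean π (fun σ : Fin n → Fin q =>
          (a * (1 - b)) ^ α.card * ∏ e ∈ α, W (σ e.1.1) (σ e.1.2)) := by
        rw [mean_mul_left, mul_pow]
    _ ≤ _ := by
        refine mean_mono hπ fun σ => ?_
        rw [← Finset.prod_const, ← Finset.prod_mul_distrib]
        refine Finset.prod_le_prod (fun e _ => ?_) fun e _ => hA _ _
        exact mul_nonneg (mul_nonneg ha (by linarith)) (hm.trans (hW _ _))

/-- The bound on the correlation for large `n`. -/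
lemma corr_le_of_large (hq : 0 < q) (hπ : ∀ k, 0 < π k) (h1 : ∑ k, π k = 1) (hQ : Q.IsSymm)
    (hQ0 : ∀ k l, 0 < Q k l) {d : ℝ} (hd : 0 < d) (hdeg : ∀ k, ∑ l, Q k l * π l = d)
    {φ : Fin q → Fin q → ℝ} {Φ : ℝ} (hΦ : 1 ≤ Φ) (hφ : ∀ i k, |φ i k| ≤ Φ)
    (horth : ∀ i j, ∑ k, π k * (φ i k * φ j k) = if i = j then 1 else 0)
    {μ : Fin q → ℝ} {r : ℝ} (hμ : ∀ i, |μ i| ≤ r)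
    (hexp : ∀ k l, Q k l / d - 1 = ∑ i, μ i * (φ i k * φ i l))
    {m M : ℝ} (hm : 0 < m) (hmQ : ∀ k l, m ≤ Q k l / d) (hM : 1 ≤ M) (hQM : ∀ k l, Q k l ≤ M)
    {u v : Fin n} (huv : u ≠ v) {D : ℕ} (hD1 : 1 ≤ D) (hDn : (D : ℝ) ^ 30 ≤ n)
    (hn : 4 * (1769472 * ((q * Φ) ^ 12 / m)) ^ 2 + 4 * M ^ 2 ≤ n) (k l : Fin q) :
    corr π Q u v k l D ≤
      ((√(16 * ((q * Φ) ^ 12 / m + (1769472 * ((q * Φ) ^ 12 / m)) ^ 2) / n *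
        ∑ t ∈ Finset.Icc 1 D, (d * r ^ 2) ^ t) : ℝ) : EReal) := by
  have : Nonempty (Fin q) := ⟨⟨0, hq⟩⟩
  have hr : 0 ≤ r := (abs_nonneg _).trans (hμ ⟨0, hq⟩)
  have hD1' : (1 : ℝ) ≤ D := by exact_mod_cast hD1
  have hΦ0 : 0 ≤ Φ := by linarith
  have hM2 : 4 * M ^ 2 ≤ n := by
    have : 0 ≤ 4 * (1769472 * ((q * Φ) ^ 12 / m)) ^ 2 := by positivity
    linarith
  have hMn : M < n := by nlinarith
  have hn0 : (0 : ℝ) < n := by linarith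
  have hQn : ∀ k l, Q k l ≤ n := fun k l => (hQM k l).trans hMn.le
  have hApos : ∀ k l, 0 < Q k l / n * (1 - Q k l / n) := fun k l =>
    mul_pos (div_pos (hQ0 k l) hn0)
      (sub_pos.2 ((div_lt_one hn0).2 ((hQM k l).trans_lt hMn)))
  have hN : ∀ β : Finset (Edge n),
      0 < mean π (edgeProd (fun k l => Q k l / n * (1 - Q k l / n)) β) := fun β =>
    mean_pos hπ fun σ => Finset.prod_pos fun e _ => hApos _ _
  refine (corr_le_sqrt_sum_coef hπ h1 hQ (fun k l => (hQ0 k l).le) hQn hdeg huv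
    (fun β => (hN β).ne') k l D).trans ?_
  rw [EReal.coe_le_coe_iff]
  refine Real.sqrt_le_sqrt (sum_le_of_admissible huv hD1 hDn (by positivity) (by positivity)
    (by nlinarith [sq_nonneg M]) (fun α hα => ?_) fun α hα hαD => ?_)
  · rw [coef_of_not_admissible hα]
    simp
  have hμ' : ∀ i, |d / n * μ i| ≤ d / n * r := fun i => by
    rw [abs_mul, abs_of_pos (div_pos hd hn0)]
    exact mul_le_mul_of_nonneg_left (hμ i) (div_pos hd hn0).le
  have hcoef := abs_coef_le (x := estimand π u v k l) (fun k => (hπ k).le) h1 hΦ hφ horth hμ'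
    (A := fun k l => Q k l / n * (1 - Q k l / n)) (B := fun k l => Q k l / n - d / n)
    (fun k l => by
      simp only [mul_assoc]
      rw [← Finset.mul_sum, ← hexp]
      field_simp) (fun k l => (hApos k l).le) (fun β => (hN β).ne')
    (abs_estimand_le hπ h1 u v k l)
    (fun σ τ h => by rw [estimand, estimand, h u (by simp), h v (by simp)]) hD1 hα hαD
  have hl : ∀ k, ∑ l, π l * (Q k l / d) = 1 := fun k => by
    rw [← div_self hd.ne']
    nth_rewrite 2 [← hdeg k]
    rw [Finset.sum_div]
    exact Finset.sum_congr rfl fun _ _ => by ring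
  have hlower := le_mean_edgeProd (fun k => (hπ k).le) h1 hl
    (fun l => by
      rw [← hl l]
      exact Finset.sum_congr rfl fun k _ => by rw [hQ.apply l k]) hm.le hmQ
    (A := fun k l => Q k l / n * (1 - Q k l / n)) (a := d / n) (b := M / n) (D := D) (by positivity)
    ((div_le_one hn0).2 hMn.le) (fun k l => by
      have h2 : d / n * (1 - M / n) * (Q k l / d) = Q k l / n * (1 - M / n) := by field_simp
      rw [h2]
      have := hQM k l
      have := hQ0 k l
      gcongr) (by
      have h2 : (D : ℝ) ^ 2 ≤ n := (pow_le_pow_right₀ hD1' (by norm_num)).trans hDn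
      have h3 : (2 * D * M) ^ 2 ≤ (n : ℝ) ^ 2 := by
        calc (2 * (D : ℝ) * M) ^ 2 = (D : ℝ) ^ 2 * (4 * M ^ 2) := by ring
          _ ≤ (n : ℝ) * n := by gcongr
          _ = _ := by ring
      have h4 : 2 * D * M ≤ (n : ℝ) := le_of_sq_le_sq h3 hn0.le
      rw [← mul_div_assoc, div_le_iff₀ hn0]
      linarith) (by positivity) hα hαD
  rw [Fintype.card_fin] at hcoef
  set kα := excess u v α
  have hkα : 0 < kα := excess_pos hα
  rw [← sq_abs]
  -- Each edge contributes `(d r / n) ^ 2` above and `d / n` below, hence `d r ^ 2 / n`. Squaring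
  -- turns the exponent 6 of `q Φ` into 12.
  calc |coef u v π (fun k l => Q k l / n * (1 - Q k l / n)) (fun k l => Q k l / n - d / n)
        (estimand π u v k l) α| ^ 2 /
          mean π (edgeProd (fun k l => Q k l / n * (1 - Q k l / n)) α)
      ≤ ((d / n * r) ^ α.card * ((q * Φ) ^ (6 * kα) * (4 * (2 * D) ^ 6) ^ (kα - 1))) ^ 2 /
          ((d / n) ^ α.card * m ^ kα / 2) := by
        gcongr
    _ = 2 * (d * r ^ 2 / n) ^ α.card *
        (((q * Φ) ^ 12 / m) ^ kα * ((4 * (2 * D) ^ 6) ^ 2) ^ (kα - 1)) := by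
        have e1 : ((d / n * r) ^ α.card) ^ 2 =
            (d * r ^ 2 / n) ^ α.card * (d / n) ^ α.card := by
          rw [← pow_mul, mul_comm α.card 2, pow_mul, ← mul_pow]
          congr 1
          ring
        have e2 : (((q : ℝ) * Φ) ^ (6 * kα)) ^ 2 = (((q : ℝ) * Φ) ^ 12) ^ kα := by
          rw [← pow_mul, ← pow_mul]
          congr 1
          ring
        have e3 : ((4 * (2 * (D : ℝ)) ^ 6) ^ (kα - 1)) ^ 2 =
            ((4 * (2 * (D : ℝ)) ^ 6) ^ 2) ^ (kα - 1) := by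
          rw [← pow_mul, ← pow_mul, mul_comm (kα - 1)]
        rw [mul_pow ((d / n * r) ^ α.card), mul_pow (((q : ℝ) * Φ) ^ (6 * kα)), e1, e2, e3, div_pow _ m]
        have : (d / n) ^ α.card ≠ 0 := (pow_pos (div_pos hd hn0) _).ne'
        field_simp

end Main

end SBM

theorem theorem6p1 (q : ℕ) (hq : 2 ≤ q)
    (π : Fin q → ℝ) (hπ_pos : ∀ k, 0 < π k) (hπ_sum : ∑ k, π k = 1)
    (Q : Matrix (Fin q) (Fin q) ℝ) (hQ_symm : Q.IsSymm) (hQ_pos : ∀ k l, 0 < Q k l)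
    (hdeg : ∀ k, ∑ l, Q k l * π l = SBM.avgDegree π Q) :
    ∃ δ : ℝ, 0 < δ ∧ ∃ C : ℝ, 0 < C ∧
      ∀ (n : ℕ) (hn : 2 ≤ n), (∀ k l, Q k l ≤ (n : ℝ)) →
        ∀ D : ℕ, (D : ℝ) ≤ (n : ℝ) ^ δ →
          ∀ k₀ l₀ : Fin q,
            SBM.corr π Q (⟨0, by omega⟩ : Fin n) (⟨1, by omega⟩ : Fin n) k₀ l₀ D ≤
              ((Real.sqrt ((C / (n : ℝ)) * ∑ t ∈ Finset.Icc 1 D,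
                (SBM.avgDegree π Q *
                  SBM.secondEigenvalueAbs (SBM.transition π Q) ^ 2) ^ t) : ℝ) : EReal) := by
  have hq0 : 0 < q := by omega
  have : Nonempty (Fin q) := ⟨⟨0, hq0⟩⟩
  set d := SBM.avgDegree π Q with hd_def
  have hd : 0 < d := by
    rw [← hdeg ⟨0, hq0⟩]
    exact Finset.sum_pos (fun l _ => mul_pos (hQ_pos _ l) (hπ_pos l)) Finset.univ_nonempty
  have htrans : SBM.transition π Q = Matrix.diagonal π * ((1 / d) • Q) := by
    rw [SBM.transition, Matrix.mul_smul]
  have hsmul : ∀ k l, ((1 / d) • Q) k l = Q k l / d := fun k l => by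
    rw [Matrix.smul_apply, smul_eq_mul]
    ring
  obtain ⟨μ, φ, horth, hexp, hμ⟩ := SBM.exists_centred_eigenfunctions
    (W := (1 / d) • Q) hπ_pos hπ_sum (fun k l => by rw [hsmul, hsmul, hQ_symm.apply l k])
    (fun k l => by rw [hsmul]; exact div_pos (hQ_pos k l) hd) (fun k => by
      simp only [hsmul, div_mul_eq_mul_div]
      rw [← Finset.sum_div, hdeg, div_self hd.ne'])
  rw [← htrans] at hμ
  simp only [hsmul] at hexp
  set r := SBM.secondEigenvalueAbs (SBM.transition π Q) with hr_def
  have hr : 0 ≤ r := (abs_nonneg _).trans (hμ ⟨0, hq0⟩)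
  obtain ⟨Φ, hΦ, hφ⟩ : ∃ Φ : ℝ, 1 ≤ Φ ∧ ∀ i k, |φ i k| ≤ Φ := by
    refine ⟨1 + ∑ i, ∑ k, |φ i k|, ?_, fun i k => ?_⟩
    · have : 0 ≤ ∑ i, ∑ k, |φ i k| :=
        Finset.sum_nonneg fun _ _ => Finset.sum_nonneg fun _ _ => abs_nonneg _
      linarith
    · have h2 : |φ i k| ≤ ∑ k, |φ i k| :=
        Finset.single_le_sum (f := fun k => |φ i k|) (fun _ _ => abs_nonneg _)
          (Finset.mem_univ k)
      have h3 : ∑ k, |φ i k| ≤ ∑ i, ∑ k, |φ i k| :=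
        Finset.single_le_sum (f := fun i => ∑ k, |φ i k|)
          (fun _ _ => Finset.sum_nonneg fun _ _ => abs_nonneg _) (Finset.mem_univ i)
      linarith
  obtain ⟨p, -, hp⟩ := Finset.exists_min_image (Finset.univ : Finset (Fin q × Fin q))
    (fun p => Q p.1 p.2 / d) Finset.univ_nonempty
  obtain ⟨p', -, hp'⟩ := Finset.exists_max_image (Finset.univ : Finset (Fin q × Fin q))
    (fun p => Q p.1 p.2) Finset.univ_nonempty
  set m := Q p.1 p.2 / d with hm_def
  have hm : 0 < m := div_pos (hQ_pos _ _) hd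
  set M := max 1 (Q p'.1 p'.2) with hM_def
  set E := ((q : ℝ) * Φ) ^ 12 / m with hE_def
  have hE : 0 < E := by
    have : (0 : ℝ) < q := by exact_mod_cast hq0
    have : 0 < Φ := by linarith
    positivity
  set N := 4 * (1769472 * E) ^ 2 + 4 * M ^ 2 with hN_def
  have hN : 0 ≤ N := by positivity
  have hC0 : 0 < 16 * (E + (1769472 * E) ^ 2) := by positivity
  have hC1 : 0 ≤ N / (d * r ^ 2) := by positivity
  -- The exponent `1 / 30` means `D ^ 30 ≤ n`. The first summand of the constant serves large `n`;
  -- the second makes the right side at least one when `n < N`. It is 0 by convention if `r = 0`, a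
  -- case treated apart.
  refine ⟨1 / 30, by norm_num, 16 * (E + (1769472 * E) ^ 2) + N / (d * r ^ 2), by linarith, ?_⟩
  intro n hn hQn D hD k₀ l₀
  have hn0 : (0 : ℝ) < n := by
    have : 0 < n := by omega
    exact_mod_cast this
  have huv : (⟨0, by omega⟩ : Fin n) ≠ ⟨1, by omega⟩ := by simp
  have hQ0 : ∀ k l, 0 ≤ Q k l := fun k l => (hQ_pos k l).le
  have hsum0 : 0 ≤ ∑ t ∈ Finset.Icc 1 D, (d * r ^ 2) ^ t :=
    Finset.sum_nonneg fun _ _ => by positivity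
  -- Here the right side vanishes, so the correlation must be shown to be at most zero. For `D = 0`
  -- only constants are tested; for `r = 0` the matrix `Q` is constant and the graph carries no
  -- information on the labels.
  have hdegenerate : D = 0 ∨ r = 0 → SBM.corr π Q (⟨0, by omega⟩ : Fin n) (⟨1, by omega⟩ : Fin n)
      k₀ l₀ D ≤ ((√0 : ℝ) : EReal) := by
    intro hcase
    refine SBM.corr_le_zero (fun k => (hπ_pos k).le) hQ0 hQn (d / n) fun α hα => ?_
    rcases Finset.eq_empty_or_nonempty α with rfl | ⟨e, he⟩
    · simp only [SBM.edgeProd, Finset.prod_empty, mul_one]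
      exact SBM.mean_estimand hπ_sum huv k₀ l₀
    · have hr0 : r = 0 := hcase.resolve_left fun h0 => by
        have := Finset.card_pos.2 ⟨e, he⟩
        omega
      have hU : ∀ k l, Q k l / n - d / n = 0 := by
        intro k l
        have h2 := hexp k l
        have h3 : ∀ i, μ i = 0 := fun i => abs_nonpos_iff.1 ((hμ i).trans hr0.le)
        simp only [h3, zero_mul, Finset.sum_const_zero] at h2
        have h4 : Q k l = d := by
          rw [sub_eq_zero, div_eq_one_iff_eq hd.ne'] at h2
          exact h2
        rw [h4, sub_self]
      have h5 : ∀ σ : Fin n → Fin q, SBM.edgeProd (fun k l => Q k l / n - d / n) α σ = 0 :=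
        fun σ => Finset.prod_eq_zero he (hU _ _)
      simp [h5, SBM.mean]
  by_cases hcase : D = 0 ∨ r = 0
  · refine (hdegenerate hcase).trans (EReal.coe_le_coe_iff.2 (Real.sqrt_le_sqrt ?_))
    exact mul_nonneg (div_nonneg (by linarith) hn0.le) hsum0
  push Not at hcase
  have hD1 : 1 ≤ D := Nat.one_le_iff_ne_zero.2 hcase.1
  have hs : 0 < d * r ^ 2 := mul_pos hd (pow_pos (lt_of_le_of_ne hr (Ne.symm hcase.2)) 2)
  by_cases hlarge : N ≤ n
  · have hDn : (D : ℝ) ^ 30 ≤ n := by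
      calc (D : ℝ) ^ 30 ≤ ((n : ℝ) ^ (1 / 30 : ℝ)) ^ 30 := by gcongr
        _ = (n : ℝ) := by
          rw [← Real.rpow_natCast, ← Real.rpow_mul hn0.le]
          norm_num
    refine (SBM.corr_le_of_large hq0 hπ_pos hπ_sum hQ_symm hQ_pos hd hdeg hΦ hφ horth hμ hexp hm
      (fun k l => hp (k, l) (Finset.mem_univ _)) (le_max_left _ _)
      (fun k l => (hp' (k, l) (Finset.mem_univ _)).trans (le_max_right _ _)) huv hD1 hDn hlarge
      k₀ l₀).trans (EReal.coe_le_coe_iff.2 (Real.sqrt_le_sqrt ?_))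
    gcongr
    linarith
  · push Not at hlarge
    refine (SBM.corr_le_one hπ_pos hπ_sum hQ0 hQn _ _ k₀ l₀ D).trans
      (EReal.coe_le_coe_iff.2 (Real.sqrt_le_sqrt ?_))
    -- The term `t = 1` alone, with the summand `N / (d r ^ 2)` of the constant, outweighs the
    -- trivial bound one.
    have h2 : d * r ^ 2 ≤ ∑ t ∈ Finset.Icc 1 D, (d * r ^ 2) ^ t := by
      have := Finset.single_le_sum (f := fun t => (d * r ^ 2) ^ t)
        (fun t _ => by positivity) (Finset.mem_Icc.2 ⟨le_rfl, hD1⟩)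
      simpa using this
    calc (1 : ℝ) ≤ N / n := (one_le_div hn0).2 hlarge.le
      _ = N / (d * r ^ 2) / n * (d * r ^ 2) := by
        rw [div_right_comm, div_mul_cancel₀ _ hs.ne']
      _ ≤ _ := by
        gcongr
        linarith
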